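/- Let $A\in\mathbb{R}^{m\times n}$ be a nonzero matrix and $b\in\mathbb{R}^m$ such that $\{x:Ax=b\}\neq\emptyset$, and let $f:\mathbb{R}^n\to\mathbb{R}\cup\{+\infty\}$ be proper, lower semicontinuous and $\rho$-weakly convex for some $\rho>0$ (that is, $f+\frac{\rho}{2}\|\cdot\|^2$ is convex), where $\|\cdot\|$ is the Euclidean norm. Let $\gamma\in(0,\rho^{-1})$, $\eta\in(0,2)$ and $\beta>0$. Write $\mathrm{Prox}_{\gamma,h}(w)=\operatorname{argmin}_x\{h(x)+\frac{1}{2\gamma}\|x-w\|^2\}$ and $\mathcal{M}_{\gamma,h}(w)=\min_x\{h(x)+\frac{1}{2\gamma}\|x-w\|^2\}$. Assume that $f$ has the implicit Lipschitz subgradient property for $\gamma$ with a constant $L_f>0$: for all $w,w'\in\mathbb{R}^n$, $$\|\nabla\mathcal{M}_{\gamma,f}(w)-\nabla\mathcal{M}_{\gamma,f}(w')\|\le L_f\|\mathrm{Prox}_{\gamma,f}(w)-\mathrm{Prox}_{\gamma,f}(w')\|.$$ Let $$\mathcal{L}_\beta(x,\lambda)=f(x)+\langle\lambda,Ax-b\rangle+\frac{\beta}{2}\|Ax-b\|^2,\qquad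 \alpha=\frac{2\beta+\gamma\eta(1-\eta/2)}{2\gamma^2\tilde\sigma_{\min}(A^TA)\beta^2},$$ where $\tilde\sigma_{\min}(A^TA)$ is the smallest positive eigenvalue of $A^TA$, and suppose that $\beta$ is so large that $$\alpha<\min\left\{\frac{1-\gamma\rho}{4\gamma(1+\gamma L_f)^2},\ \frac{1}{8\gamma}\left(\frac{2}{\eta}-1\right)\right\}.$$ Let $\{(x^k,z^k,\lambda^k)\}_{k\ge0}$ be generated by the Moreau envelope augmented Lagrangian method (MEAL) with fixed penalty parameter $\beta$: for all $k\ge0$, $$x^{k+1}=\mathrm{Prox}_{\gamma,\mathcal{L}_\beta(\cdot,\lambda^k)}(z^k),\qquad z^{k+1}=z^k-\eta(z^k-x^{k+1}),\qquad \lambda^{k+1}=\lambda^k+\beta(Ax^{k+1}-b),$$ with arbitrary $x^0,z^0,\lambda^0$, and assume that this sequence is bounded. Let $(x^*,\lambda^*)$ be a limit point of $\{(x^k,\lambda^k)\}$, and let $$\mathcal{P}_{\mathrm{meal}}(x,z,\lambda,\hat z)=\mathcal{L}_\beta(x,\lambda)+\frac{1}{2\gamma}\|x-z\|^2+3\alpha\|z-\hat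 z\|^2 .$$ Suppose that $h=\mathcal{P}_{\mathrm{meal}}$ has the Kurdyka-Łojasiewicz property at $y^*=(x^*,x^*,\lambda^*,x^*)$ with an exponent $\theta\in[0,1)$; that is, with $\partial h$ the limiting subdifferential and $\mathrm{dom}(\partial h)=\{y:\partial h(y)\ne\emptyset\}$, one has $y^*\in\mathrm{dom}(\partial h)$ and there are a neighborhood $U$ of $y^*$ and constants $\nu,c>0$ such that $\varphi(s)=cs^{1-\theta}$ satisfies $\varphi'(h(y)-h(y^*))\cdot\mathrm{dist}(0,\partial h(y))\ge1$ for all $y\in U\cap\mathrm{dom}(\partial h)$ with $h(y^*)<h(y)<h(y^*)+\nu$. Write $\hat y^k=(x^k,z^k,\lambda^k)$ and $\hat y^*=(x^*,x^*,\lambda^*)$. Then: (a) the whole sequence $\{\hat y^k\}$ converges to $\hat y^*$; (b) (1) if $\theta=0$, then $\hat y^k=\hat y^*$ for all sufficiently large $k$; (2) if $\theta\in(0,\frac12]$, then there are $k_0>0$, $c>0$ and $\tau\in(0,1)$ with $\|\hat y^k-\hat y^*\|\le c\tau^k$ for all $k\ge k_0$; (3) if $\theta\in(\frac12,1)$, then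 there are $k_0>0$ and $c>0$ with $\|\hat y^k-\hat y^*\|\le c\,k^{-\frac{1-\theta}{2\theta-1}}$ for all $k\ge k_0$. -/

import Mathlib

open Filter Topology

noncomputable section

namespace MEAL

/-! Extended-real-valued functions `h : V → ℝ ∪ {+∞}` are functions into `EReal` that do not take
the value `⊥` (this is part of `IsProper`). -/

section General

variable {V : Type*} [NormedAddCommGroup V] [InnerProductSpace ℝ V]

/-- A proper function: never `-∞`, and not identically `+∞`. -/
def IsProper (h : V → EReal) : Prop :=
  (∀ x, h x ≠ ⊥) ∧ ∃ x, h x ≠ ⊤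

/-- Convexity on the whole space of a function with values in `ℝ ∪ {+∞}`. -/
def IsConvex (h : V → EReal) : Prop :=
  ∀ x y : V, ∀ a b : ℝ, 0 < a → 0 < b → a + b = 1 →
    h (a • x + b • y) ≤ (a : EReal) * h x + (b : EReal) * h y

/-- Weak convexity with modulus `ρ`: the function `h + (ρ/2)‖·‖²` is convex. -/
def IsWeaklyConvex (ρ : ℝ) (h : V → EReal) : Prop :=
  IsConvex (fun x => h x + ((ρ / 2 * ‖x‖ ^ 2 : ℝ) : EReal))

/-- The Fréchet subdifferential of `h` at `x` (empty outside the domain of `h`): the vectors `v`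
with `liminf_{u → x, u ≠ x} (h u - h x - ⟪v, u - x⟫) / ‖u - x‖ ≥ 0`, with the lower limit
spelled out by `ε`. -/
def frechetSubdiff (h : V → EReal) (x : V) : Set V :=
  {v | h x < ⊤ ∧ ∀ ε : ℝ, 0 < ε → ∀ᶠ u in 𝓝 x,
    h x + ((inner ℝ v (u - x) - ε * ‖u - x‖ : ℝ) : EReal) ≤ h u}

/-- The limiting subdifferential of `h` at `x` (empty outside the domain of `h`). -/
def subdiff (h : V → EReal) (x : V) : Set V :=
  {v | h x < ⊤ ∧ ∃ (xs vs : ℕ → V), Tendsto xs atTop (𝓝 x) ∧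
    Tendsto (fun t => h (xs t)) atTop (𝓝 (h x)) ∧
    (∀ t, vs t ∈ frechetSubdiff h (xs t)) ∧ Tendsto vs atTop (𝓝 v)}

/-- The Kurdyka-Łojasiewicz property of `h` at `xs ∈ dom ∂h` with exponent `θ`, the
desingularizing function being `φ s = c * s ^ (1 - θ)`. -/
def HasKLPropertyAt (h : V → EReal) (θ : ℝ) (xs : V) : Prop :=
  (subdiff h xs).Nonempty ∧
  ∃ U ∈ 𝓝 xs, ∃ ν : ℝ, 0 < ν ∧ ∃ c : ℝ, 0 < c ∧
    ∀ x ∈ U, (subdiff h x).Nonempty → h xs < h x → h x < h xs + (ν : EReal) →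
      1 ≤ deriv (fun s : ℝ => c * s ^ (1 - θ)) ((h x).toReal - (h xs).toReal) *
        Metric.infDist 0 (subdiff h x)

/-- The Moreau envelope of `h` with parameter `γ`. -/
def moreauEnv (γ : ℝ) (h : V → EReal) (z : V) : EReal :=
  ⨅ x, (h x + ((1 / (2 * γ) * ‖x - z‖ ^ 2 : ℝ) : EReal))

/-- The proximity operator, as the set of minimizers in the Moreau envelope. -/
def prox (γ : ℝ) (h : V → EReal) (z : V) : Set V :=
  {x | ∀ u, h x + ((1 / (2 * γ) * ‖x - z‖ ^ 2 : ℝ) : EReal) ≤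
    h u + ((1 / (2 * γ) * ‖u - z‖ ^ 2 : ℝ) : EReal)}

/-- The implicit Lipschitz subgradient property of `h` for the parameter `γ`, with constant `L`:
gradients of the Moreau envelope at `w`, `w'` are `L`-Lipschitz in the proximal points. -/
def ImplicitLipschitzSubgradient [CompleteSpace V] (γ : ℝ) (h : V → EReal) (L : ℝ) : Prop :=
  ∀ w w' u v : V, u ∈ prox γ h w → v ∈ prox γ h w' →
    ‖gradient (fun z => (moreauEnv γ h z).toReal) w -
      gradient (fun z => (moreauEnv γ h z).toReal) w'‖ ≤ L * ‖u - v‖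

end General

variable {m n : ℕ}

/-- `A x - b`, in Euclidean space. -/
def residual (A : Matrix (Fin m) (Fin n) ℝ) (b : EuclideanSpace ℝ (Fin m))
    (x : EuclideanSpace ℝ (Fin n)) : EuclideanSpace ℝ (Fin m) :=
  Matrix.toEuclideanLin A x - b

/-- The smallest positive eigenvalue of `Aᵀ A` (for `A ≠ 0`). -/
def minPosEigenvalue (A : Matrix (Fin m) (Fin n) ℝ) : ℝ :=
  sInf {μ : ℝ | 0 < μ ∧ Module.End.HasEigenvalue (Matrix.toLin' (A.transpose * A)) μ}

/-- The augmented Lagrangian. -/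
def augLagrangian (f : EuclideanSpace ℝ (Fin n) → EReal) (A : Matrix (Fin m) (Fin n) ℝ)
    (b : EuclideanSpace ℝ (Fin m)) (β : ℝ)
    (x : EuclideanSpace ℝ (Fin n)) (lam : EuclideanSpace ℝ (Fin m)) : EReal :=
  f x + ((inner ℝ lam (residual A b x) + β / 2 * ‖residual A b x‖ ^ 2 : ℝ) : EReal)

/-- `P_β(x, z, λ) = L_β(x, λ) + ‖x - z‖² / (2γ)`. -/
def proxAugLagrangian (f : EuclideanSpace ℝ (Fin n) → EReal) (A : Matrix (Fin m) (Fin n) ℝ)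
    (b : EuclideanSpace ℝ (Fin m)) (β γ : ℝ)
    (x z : EuclideanSpace ℝ (Fin n)) (lam : EuclideanSpace ℝ (Fin m)) : EReal :=
  augLagrangian f A b β x lam + ((1 / (2 * γ) * ‖x - z‖ ^ 2 : ℝ) : EReal)

/-- `α = (2β + γη(1 - η/2)) / (2 c β²)` with `c = γ² σ`, `σ` the smallest positive eigenvalue of
`Aᵀ A`. -/
def alpha (A : Matrix (Fin m) (Fin n) ℝ) (β γ η : ℝ) : ℝ :=
  (2 * β + γ * η * (1 - η / 2)) / (2 * (γ ^ 2 * minPosEigenvalue A) * β ^ 2)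

/-- `ℝⁿ × ℝⁿ × ℝᵐ` with the Euclidean norm. -/
abbrev Triple (n m : ℕ) : Type :=
  WithLp 2 (EuclideanSpace ℝ (Fin n) ×
    WithLp 2 (EuclideanSpace ℝ (Fin n) × EuclideanSpace ℝ (Fin m)))

/-- `ℝⁿ × ℝⁿ × ℝᵐ × ℝⁿ` with the Euclidean norm. -/
abbrev Quadruple (n m : ℕ) : Type :=
  WithLp 2 (EuclideanSpace ℝ (Fin n) × WithLp 2 (EuclideanSpace ℝ (Fin n) ×
    WithLp 2 (EuclideanSpace ℝ (Fin m) × EuclideanSpace ℝ (Fin n))))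

/-- The point `(x, z, λ)`. -/
def triple (x z : EuclideanSpace ℝ (Fin n)) (lam : EuclideanSpace ℝ (Fin m)) : Triple n m :=
  WithLp.toLp 2 (x, WithLp.toLp 2 (z, lam))

/-- The point `(x, z, λ, ẑ)`. -/
def quadruple (x z : EuclideanSpace ℝ (Fin n)) (lam : EuclideanSpace ℝ (Fin m))
    (zhat : EuclideanSpace ℝ (Fin n)) : Quadruple n m :=
  WithLp.toLp 2 (x, WithLp.toLp 2 (z, WithLp.toLp 2 (lam, zhat)))

/-- The Lyapunov function `P_meal(x, z, λ, ẑ) = P_β(x, z, λ) + 3α‖z - ẑ‖²`. -/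
def lyapunov (f : EuclideanSpace ℝ (Fin n) → EReal) (A : Matrix (Fin m) (Fin n) ℝ)
    (b : EuclideanSpace ℝ (Fin m)) (β γ η : ℝ) (y : Quadruple n m) : EReal :=
  proxAugLagrangian f A b β γ y.fst y.snd.fst y.snd.snd.fst +
    ((3 * alpha A β γ η * ‖y.snd.fst - y.snd.snd.snd‖ ^ 2 : ℝ) : EReal)

/-- `(xᵏ, zᵏ, λᵏ)` is generated by MEAL with fixed penalty parameter `β`, proximal parameter `γ`
and step size `η`; the start `(z⁰, λ⁰)` is arbitrary, and so is `x⁰`, which the updates never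
read. -/
structure IsMEALSequence (f : EuclideanSpace ℝ (Fin n) → EReal) (A : Matrix (Fin m) (Fin n) ℝ)
    (b : EuclideanSpace ℝ (Fin m)) (β γ η : ℝ)
    (x z : ℕ → EuclideanSpace ℝ (Fin n)) (lam : ℕ → EuclideanSpace ℝ (Fin m)) : Prop where
  x_update : ∀ k, x (k + 1) ∈ prox γ (fun u => augLagrangian f A b β u (lam k)) (z k)
  z_update : ∀ k, z (k + 1) = z k - η • (z k - x (k + 1))
  lam_update : ∀ k, lam (k + 1) = lam k + β • residual A b (x (k + 1))

end MEAL

end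

/-! The method is treated as a descent method for the Lyapunov function, evaluated at
`yᵏ = (xᵏ, zᵏ, λᵏ, zᵏ⁻¹)`.

Optimality of the proximal step gives a subgradient `pᵏ = -(Aᵀ λᵏ + (xᵏ - zᵏ⁻¹) / γ)` of `f` at
`xᵏ` in the weakly convex sense: `f` lies above the paraboloid
`f xᵏ + ⟪pᵏ, · - xᵏ⟫ - ρ/2 ‖· - xᵏ‖²` (`IsWeakSubgradient.of_isMin`). Such a subgradient is the
gradient of the Moreau envelope at `xᵏ + γ pᵏ`, so the implicit Lipschitz property makes the
subgradients Lipschitz in their base points (`ImplicitLipschitzSubgradient.norm_sub_le`). As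
`λᵏ⁺¹ - λᵏ` lies in the range of `A`, on which `‖Aᵀ ·‖² ≥ σ ‖·‖²`
(`minPosEigenvalue_pos_and_le`), the increments of `λ` are controlled by those of `x` and `z`
(`norm_sq_multiplier_le`), and for small `α` the decrease of the augmented Lagrangian in the
primal variables outweighs its increase in the multiplier: the Lyapunov function decreases by a
multiple of `‖yᵏ⁺¹ - yᵏ‖²` (`exists_sufficient_decrease`). Besides, it has at `yᵏ⁺¹` a subgradient
of norm at most a multiple of `‖yᵏ⁺¹ - yᵏ‖` (`exists_subgradient_bound`).

The orbit being bounded, the values converge, the steps tend to zero, and a subsequence of `yᵏ`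
tends to `(x*, x*, λ*, x*)` with convergence of the values
(`exists_subseq_lyapunov_tendsto`). The Kurdyka-Łojasiewicz inequality then bounds each step by the
decrease of `W = ‖last step‖ + M (value gap) ^ (1 - θ)` (`step_le_sub`). So
`‖y - y*‖ + W` does not increase once it is small, which gives convergence, and `‖y - y*‖ ≤ W`;
the inequality turns into a recursion for `W` whose decay is the claimed rate
(`tendsto_and_rate_of_lojasiewicz`). -/

namespace MEAL

/-! ### Weak subgradients and the Moreau envelope -/

section WeakSubgradient

variable {V : Type*} [NormedAddCommGroup V] [InnerProductSpace ℝ V]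

/-- `p` is a subgradient of the `ρ`-weakly convex function `h` at `x`: `h` is finite at `x` and
lies above the downward paraboloid of curvature `ρ` through `(x, h x)` with slope `p`. -/
def IsWeakSubgradient (ρ : ℝ) (h : V → EReal) (x p : V) : Prop :=
  ∃ r : ℝ, h x = r ∧
    ∀ u, ((r + (inner ℝ p (u - x) - ρ / 2 * ‖u - x‖ ^ 2) : ℝ) : EReal) ≤ h u

/-- First-order optimality: a minimizer of `h + G`, with `G` quadratic along the lines through it,
carries the weak subgradient `-∇G`. -/
theorem IsWeakSubgradient.of_isMin {ρ : ℝ} {h : V → EReal} (hp : IsProper h)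
    (hwc : IsWeaklyConvex ρ h) {G : V → ℝ} {x g : V} {Q : V → ℝ}
    (hG : ∀ (t : ℝ) (d : V), G (x + t • d) = G x + t * inner ℝ g d + t ^ 2 * Q d)
    (hmin : ∀ u, h x + (G x : EReal) ≤ h u + (G u : EReal)) :
    IsWeakSubgradient ρ h x (-g) := by
  obtain ⟨hbot, u₀, hu₀⟩ := hp
  have hxtop : h x ≠ ⊤ := by
    intro hx
    have h1 := hmin u₀
    rw [hx, EReal.top_add_coe, top_le_iff] at h1
    lift h u₀ to ℝ using ⟨hu₀, hbot _⟩ with c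
    exact EReal.coe_ne_top _ (by exact_mod_cast h1)
  lift h x to ℝ using ⟨hxtop, hbot _⟩ with r hr
  refine ⟨r, hr.symm, fun u => ?_⟩
  by_cases hu : h u = ⊤
  · rw [hu]; exact le_top
  have hc := fun a b ha hb hab => hwc x u a b ha hb hab
  lift h u to ℝ using ⟨hu, hbot _⟩ with s hs
  simp only [← hr] at hc
  set d := u - x with hd
  have key : ∀ t : ℝ, 0 < t → t < 1 →
      0 ≤ (s - r + inner ℝ g d + ρ / 2 * ‖d‖ ^ 2) + t * (Q d - ρ / 2 * ‖d‖ ^ 2) := by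
    intro t ht ht1
    have h1 := hc (1 - t) t (by linarith) ht (by ring)
    have hpt : (1 - t) • x + t • u = x + t • d := by
      rw [hd]; module
    rw [hpt] at h1
    have h2 := hmin (x + t • d)
    have h3 : h (x + t • d) ≠ ⊤ := by
      intro h4
      rw [h4, EReal.top_add_coe, top_le_iff] at h1
      exact EReal.coe_ne_top _ (by exact_mod_cast h1)
    lift h (x + t • d) to ℝ using ⟨h3, hbot _⟩ with q
    rw [hG] at h2
    norm_cast at h1 h2
    have hu' : u = x + d := by rw [hd]; abel
    rw [hu', norm_add_sq_real, norm_add_sq_real, norm_smul, inner_smul_right, mul_pow,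
      Real.norm_eq_abs, sq_abs] at h1
    have h5 : 0 ≤ t * ((s - r + inner ℝ g d + ρ / 2 * ‖d‖ ^ 2) +
        t * (Q d - ρ / 2 * ‖d‖ ^ 2)) := by nlinarith
    exact nonneg_of_mul_nonneg_right h5 ht
  have hlim : Tendsto (fun t : ℝ => (s - r + inner ℝ g d + ρ / 2 * ‖d‖ ^ 2) +
      t * (Q d - ρ / 2 * ‖d‖ ^ 2)) (𝓝[>] 0)
      (𝓝 ((s - r + inner ℝ g d + ρ / 2 * ‖d‖ ^ 2) + 0 * (Q d - ρ / 2 * ‖d‖ ^ 2))) :=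
    ((continuous_const.add (continuous_id.mul continuous_const)).tendsto 0).mono_left
      nhdsWithin_le_nhds
  have h0 := ge_of_tendsto hlim (by
    filter_upwards [Ioo_mem_nhdsGT (zero_lt_one (α := ℝ))] with t ht using key t ht.1 ht.2)
  rw [inner_neg_left]
  norm_cast
  linarith

/-- Around a proximal point, the shifted proximal objective is bounded below by the first-order
expansion of the envelope, up to a quadratic error. -/
theorem IsWeakSubgradient.le_add_norm_sq {ρ γ : ℝ} {h : V → EReal} {x p : V} {r : ℝ}
    (hγ : 0 < γ) (hγρ : γ * ρ < 1)
    (hp : ∀ u, ((r + (inner ℝ p (u - x) - ρ / 2 * ‖u - x‖ ^ 2) : ℝ) : EReal) ≤ h u) (d u : V) :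
    ((r + γ / 2 * ‖p‖ ^ 2 + inner ℝ p d - 1 / (2 * γ * (1 - γ * ρ)) * ‖d‖ ^ 2 : ℝ) : EReal) ≤
      h u + ((1 / (2 * γ) * ‖u - (x + γ • p + d)‖ ^ 2 : ℝ) : EReal) := by
  refine le_trans ?_ (add_le_add_left (hp u) _)
  norm_cast
  set e := u - x with he
  have h1 : u - (x + γ • p + d) = e - (γ • p + d) := by rw [he]; abel
  rw [h1, norm_sub_sq_real e, norm_add_sq_real (γ • p), inner_add_right, inner_smul_right, inner_smul_left,
    norm_smul, mul_pow, Real.norm_eq_abs, sq_abs, real_inner_comm p e]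
  have h2 : (inner ℝ e d : ℝ) ≤ ‖e‖ * ‖d‖ := real_inner_le_norm e d
  have hm : 0 < 1 - γ * ρ := by linarith
  simp only [conj_trivial]
  have h3 : (0 : ℝ) ≤ ((1 - γ * ρ) * ‖e‖ - ‖d‖) ^ 2 / (2 * γ * (1 - γ * ρ)) := by positivity
  have h4 : ((1 - γ * ρ) * ‖e‖ - ‖d‖) ^ 2 / (2 * γ * (1 - γ * ρ)) =
      (1 / (2 * γ) - ρ / 2) * ‖e‖ ^ 2 - 1 / γ * (‖e‖ * ‖d‖) +
        1 / (2 * γ * (1 - γ * ρ)) * ‖d‖ ^ 2 := by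
    field_simp
    ring
  have h5 : 1 / γ * (inner ℝ e d : ℝ) ≤ 1 / γ * (‖e‖ * ‖d‖) := by gcongr
  have h6 : 1 / (2 * γ) * (‖e‖ ^ 2 - 2 * (γ * inner ℝ p e + inner ℝ e d) +
      (γ ^ 2 * ‖p‖ ^ 2 + 2 * (γ * inner ℝ p d) + ‖d‖ ^ 2)) =
      1 / (2 * γ) * ‖e‖ ^ 2 - inner ℝ p e - 1 / γ * inner ℝ e d + γ / 2 * ‖p‖ ^ 2 + inner ℝ p d
        + 1 / (2 * γ) * ‖d‖ ^ 2 := by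
    field_simp
    ring
  have h7 : 0 ≤ 1 / (2 * γ) * ‖d‖ ^ 2 := by positivity
  rw [h6]
  linarith

theorem IsWeakSubgradient.mem_prox {ρ γ : ℝ} {h : V → EReal} {x p : V}
    (hγ : 0 < γ) (hγρ : γ * ρ < 1) (hp : IsWeakSubgradient ρ h x p) :
    x ∈ prox γ h (x + γ • p) := by
  obtain ⟨r, hr, hp⟩ := hp
  intro u
  have h1 := IsWeakSubgradient.le_add_norm_sq hγ hγρ hp 0 u
  simp only [add_zero, inner_zero_right, norm_zero] at h1
  refine le_trans (le_of_eq ?_) h1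
  rw [hr, ← EReal.coe_add, sub_add_cancel_left, norm_neg, norm_smul, mul_pow, Real.norm_eq_abs,
    sq_abs]
  congr 1
  field_simp
  ring

theorem IsWeakSubgradient.hasGradientAt_moreauEnv [CompleteSpace V] {ρ γ : ℝ} {h : V → EReal}
    {x p : V} (hγ : 0 < γ) (hγρ : γ * ρ < 1) (hp : IsWeakSubgradient ρ h x p) :
    HasGradientAt (fun w => (moreauEnv γ h w).toReal) p (x + γ • p) := by
  obtain ⟨r, hr, hp⟩ := hp
  set w := x + γ • p with hw
  set K := 1 / (2 * γ * (1 - γ * ρ)) with hK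
  have hm : 0 < 1 - γ * ρ := by linarith
  have hlow : ∀ d, ((r + γ / 2 * ‖p‖ ^ 2 + inner ℝ p d - K * ‖d‖ ^ 2 : ℝ) : EReal) ≤
      moreauEnv γ h (w + d) := fun d =>
    le_iInf fun u => IsWeakSubgradient.le_add_norm_sq hγ hγρ hp d u
  have hup : ∀ d, moreauEnv γ h (w + d) ≤
      ((r + γ / 2 * ‖p‖ ^ 2 + inner ℝ p d + 1 / (2 * γ) * ‖d‖ ^ 2 : ℝ) : EReal) := by
    intro d
    refine (iInf_le _ x).trans (le_of_eq ?_)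
    have h1 : x - (w + d) = -(γ • p + d) := by rw [hw]; abel
    rw [hr, ← EReal.coe_add, h1, norm_neg, norm_add_sq_real, inner_smul_left, norm_smul, mul_pow,
      Real.norm_eq_abs, sq_abs]
    simp only [conj_trivial]
    congr 1
    field_simp
    ring
  have hreal : ∀ d, ∃ s : ℝ, moreauEnv γ h (w + d) = s := by
    intro d
    induction h1 : moreauEnv γ h (w + d) with
    | bot => have := hlow d; rw [h1, le_bot_iff] at this; exact absurd this (EReal.coe_ne_bot _)
    | top => have := hup d; rw [h1, top_le_iff] at this; exact absurd this (EReal.coe_ne_top _)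
    | coe s => exact ⟨s, rfl⟩
  choose M hM using hreal
  have hM1 : ∀ d, r + γ / 2 * ‖p‖ ^ 2 + inner ℝ p d - K * ‖d‖ ^ 2 ≤ M d := fun d => by
    have := hlow d; rw [hM] at this; exact_mod_cast this
  have hM2 : ∀ d, M d ≤ r + γ / 2 * ‖p‖ ^ 2 + inner ℝ p d + 1 / (2 * γ) * ‖d‖ ^ 2 := fun d => by
    have := hup d; rw [hM] at this; exact_mod_cast this
  have hM0 : M 0 = r + γ / 2 * ‖p‖ ^ 2 := by
    have h1 := hM1 0
    have h2 := hM2 0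
    simp at h1 h2
    linarith
  rw [hasGradientAt_iff_hasFDerivAt, hasFDerivAt_iff_isLittleO_nhds_zero]
  have hO : (fun d => (moreauEnv γ h (w + d)).toReal - (moreauEnv γ h w).toReal -
      (InnerProductSpace.toDual ℝ V p) d) =O[𝓝 0] fun d : V => ‖d‖ ^ 2 := by
    refine Asymptotics.IsBigO.of_bound (K + 1 / (2 * γ)) (Eventually.of_forall fun d => ?_)
    have h0 : moreauEnv γ h w = M 0 := by rw [← hM, add_zero]
    rw [hM, h0, EReal.toReal_coe, EReal.toReal_coe, hM0, InnerProductSpace.toDual_apply_apply,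
      norm_pow, norm_norm, Real.norm_eq_abs, abs_le]
    have hKpos : 0 ≤ K * ‖d‖ ^ 2 := by positivity
    have h7 : 0 ≤ 1 / (2 * γ) * ‖d‖ ^ 2 := by positivity
    constructor <;> [linarith [hM1 d]; linarith [hM2 d]]
  refine hO.trans_isLittleO ?_
  simpa using (Asymptotics.isLittleO_norm_pow_id (E' := V) one_lt_two)

/-- Under the implicit Lipschitz subgradient property, subgradients are Lipschitz functions of
their base points: they are the gradients of the Moreau envelope at `x + γ p`. -/
theorem ImplicitLipschitzSubgradient.norm_sub_le [CompleteSpace V] {ρ γ L : ℝ} {h : V → EReal}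
    (hL : ImplicitLipschitzSubgradient γ h L) (hγ : 0 < γ) (hγρ : γ * ρ < 1) {x y p q : V}
    (hp : IsWeakSubgradient ρ h x p) (hq : IsWeakSubgradient ρ h y q) :
    ‖p - q‖ ≤ L * ‖x - y‖ := by
  have h1 := hL _ _ x y (hp.mem_prox hγ hγρ) (hq.mem_prox hγ hγρ)
  rwa [(hp.hasGradientAt_moreauEnv hγ hγρ).gradient,
    (hq.hasGradientAt_moreauEnv hγ hγρ).gradient] at h1

/-- A global lower bound with quadratic error makes `v` a Fréchet subgradient. -/
theorem mem_frechetSubdiff_of_le {h : V → EReal} {y v : V} {K : ℝ} {r : ℝ} (hr : h y = r)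
    (hv : ∀ u, ((r + (inner ℝ v (u - y) - K * ‖u - y‖ ^ 2) : ℝ) : EReal) ≤ h u) :
    v ∈ frechetSubdiff h y := by
  refine ⟨by rw [hr]; exact EReal.coe_lt_top r, fun ε hε => ?_⟩
  have hK : 0 < |K| + 1 := by positivity
  filter_upwards [Metric.ball_mem_nhds y (div_pos hε hK)] with u hu
  refine le_trans ?_ (hv u)
  rw [hr]
  norm_cast
  rw [Metric.mem_ball, dist_eq_norm, lt_div_iff₀ hK] at hu
  have h1 : K * ‖u - y‖ ^ 2 ≤ ε * ‖u - y‖ := by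
    have h2 : K * ‖u - y‖ ≤ ε := by
      nlinarith [norm_nonneg (u - y), le_abs_self K]
    nlinarith [norm_nonneg (u - y)]
  linarith

theorem frechetSubdiff_subset_subdiff (h : V → EReal) (y : V) :
    frechetSubdiff h y ⊆ subdiff h y := fun v hv =>
  ⟨hv.1, fun _ => y, fun _ => v, tendsto_const_nhds, tendsto_const_nhds, fun _ => hv,
    tendsto_const_nhds⟩

end WeakSubgradient

/-! ### Convergence and rates from the Łojasiewicz inequality -/

section Rates

/-- Tangent-line inequality for the concave power `s ↦ s ^ (1 - θ)`, multiplied by `s ^ θ`. -/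
theorem sub_mul_le_rpow_mul_sub {θ s s' : ℝ} (hθ0 : 0 ≤ θ) (hθ1 : θ < 1) (hs : 0 < s)
    (hs' : 0 ≤ s') : (1 - θ) * (s - s') ≤ s ^ θ * (s ^ (1 - θ) - s' ^ (1 - θ)) := by
  have h1 := rpow_one_add_le_one_add_mul_self (s := s' / s - 1)
    (by have := div_nonneg hs' hs.le; linarith) (p := 1 - θ) (by linarith) (by linarith)
  rw [add_sub_cancel, Real.div_rpow hs' hs.le, div_le_iff₀ (Real.rpow_pos_of_pos hs _)] at h1
  have h2 : s ^ θ * s ^ (1 - θ) = s := by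
    rw [← Real.rpow_add hs, add_sub_cancel, Real.rpow_one]
  have h3 := mul_le_mul_of_nonneg_left h1 (Real.rpow_nonneg hs.le θ)
  have h4 : s ^ θ * ((1 + (1 - θ) * (s' / s - 1)) * s ^ (1 - θ)) =
      s + (1 - θ) * (s' - s) := by
    rw [mul_left_comm, h2]
    field_simp
  rw [mul_sub (s ^ θ), h2]
  linarith

/-- If `W (k+1) ^ (1+p)` is controlled by the decrease of `W`, then `W⁻ᵖ` grows at least
linearly. -/
theorem exists_mul_le_rpow_neg {W : ℕ → ℝ} {p C : ℝ} (hp : 0 < p) (hC : 0 < C)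
    (hanti : Antitone W) (hWC : ∀ k, W k ^ p ≤ C)
    (hrec : ∀ k, W (k + 1) ^ (1 + p) ≤ C * (W k - W (k + 1))) :
    ∃ μ : ℝ, 0 < μ ∧ ∀ k, 0 < W k → μ * k ≤ W k ^ (-p) := by
  refine ⟨p / (2 * C) / (1 + p / 2), by positivity, fun k => ?_⟩
  induction k with
  | zero => intro h; simpa using Real.rpow_nonneg h.le _
  | succ k ih =>
    intro hk
    have hk0 : 0 < W k := hk.trans_le (hanti (Nat.le_succ k))
    have ih := ih hk0
    set w := W (k + 1) with hw
    have hwp : 0 < w ^ p := Real.rpow_pos_of_pos hk _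
    set t := w ^ p / C with ht
    have htpos : 0 < t := by positivity
    have ht1 : t ≤ 1 := (div_le_one hC).2 (hWC _)
    have h1 : w * (1 + t) ≤ W k := by
      have h2 := hrec k
      rw [Real.rpow_add hk, Real.rpow_one, ← div_le_iff₀' hC] at h2
      rw [ht]
      calc w * (1 + w ^ p / C) = w + w * w ^ p / C := by ring
        _ ≤ W k := by linarith
    have h3 : W k ^ (-p) ≤ w ^ (-p) * (1 + t) ^ (-p) := by
      rw [← Real.mul_rpow hk.le (by positivity)]
      exact Real.rpow_le_rpow_of_nonpos (by positivity) h1 (by linarith)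
    have hlog : t / 2 ≤ Real.log (1 + t) := by
      have h4 := Real.one_sub_inv_le_log_of_pos (show 0 < 1 + t by linarith)
      refine le_trans ?_ h4
      rw [show 1 - (1 + t)⁻¹ = t / (1 + t) by field_simp; ring]
      gcongr
      linarith
    have h5 : 1 + p * t / 2 ≤ (1 + t) ^ p := by
      rw [Real.rpow_def_of_pos (by linarith)]
      refine le_trans ?_ (Real.add_one_le_exp _)
      nlinarith
    have h6 : (1 + t) ^ (-p) ≤ 1 - p * t / 2 / (1 + p / 2) := by
      rw [Real.rpow_neg (by linarith)]
      calc ((1 + t) ^ p)⁻¹ ≤ (1 + p * t / 2)⁻¹ := by gcongr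
        _ = 1 - p * t / 2 / (1 + p * t / 2) := by field_simp; ring
        _ ≤ 1 - p * t / 2 / (1 + p / 2) := by
          gcongr
          nlinarith
    have h7 : w ^ (-p) * t = 1 / C := by
      rw [ht, Real.rpow_neg hk.le]
      field_simp
    have h8 : W k ^ (-p) ≤ w ^ (-p) - p / (2 * C) / (1 + p / 2) := by
      refine h3.trans ((mul_le_mul_of_nonneg_left h6 (Real.rpow_nonneg hk.le _)).trans ?_)
      have : w ^ (-p) * (1 - p * t / 2 / (1 + p / 2)) =
          w ^ (-p) - p / 2 / (1 + p / 2) * (w ^ (-p) * t) := by ring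
      rw [this, h7]
      apply le_of_eq
      field_simp
    push_cast
    linarith

/-- Geometric decay from a linear recursion, for a sequence dominated by `W` from `K` on. -/
theorem exists_le_geometric {W D : ℕ → ℝ} {C : ℝ} {K : ℕ} (hC : 0 < C)
    (hW : ∀ k ≥ K, 0 ≤ W k) (hD : ∀ k ≥ K, D k ≤ W k)
    (hrec : ∀ k ≥ K, W (k + 1) ≤ C * (W k - W (k + 1))) :
    ∃ c : ℝ, 0 < c ∧ ∃ τ : ℝ, 0 < τ ∧ τ < 1 ∧ ∀ k ≥ K, D k ≤ c * τ ^ k := by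
  have hτ : 0 < C / (1 + C) := by positivity
  refine ⟨(W K + 1) / (C / (1 + C)) ^ K, by have := hW K le_rfl; positivity, C / (1 + C), hτ,
    by rw [div_lt_one (by positivity)]; linarith, fun k hk => (hD k hk).trans ?_⟩
  induction k, hk using Nat.le_induction with
  | base => rw [div_mul_cancel₀ _ (by positivity)]; linarith
  | succ k hk ih =>
    have h1 := hrec k hk
    have h2 : W (k + 1) ≤ C / (1 + C) * W k := by
      rw [div_mul_eq_mul_div, le_div_iff₀ (by positivity)]
      linarith
    rw [pow_succ]
    calc W (k + 1) ≤ C / (1 + C) * W k := h2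
      _ ≤ C / (1 + C) * ((W K + 1) / (C / (1 + C)) ^ K * (C / (1 + C)) ^ k) := by gcongr
      _ = _ := by ring

/-- Polynomial decay from a superlinear recursion, for a sequence dominated by `W` from `K`
on. -/
theorem exists_le_rpow {W D : ℕ → ℝ} {p C : ℝ} {K : ℕ} (hp : 0 < p) (hC : 0 < C)
    (hW : ∀ k ≥ K, 0 ≤ W k) (hanti : ∀ k ≥ K, W (k + 1) ≤ W k) (hD : ∀ k ≥ K, D k ≤ W k)
    (hrec : ∀ k ≥ K, W (k + 1) ^ (1 + p) ≤ C * (W k - W (k + 1))) :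
    ∃ k₀ : ℕ, ∃ c : ℝ, 0 < c ∧ ∀ k ≥ k₀, D k ≤ c * ((k + 2 : ℕ) : ℝ) ^ (-(1 / p)) := by
  have hantiV : Antitone fun j => W (K + j) :=
    antitone_nat_of_succ_le fun j => hanti _ (Nat.le_add_right K j)
  obtain ⟨μ, hμ, hgrow⟩ := exists_mul_le_rpow_neg (W := fun j => W (K + j)) (C := C + W K ^ p) hp
    (by have := Real.rpow_nonneg (hW K le_rfl) p; positivity) hantiV
    (fun j => by
      have := Real.rpow_le_rpow (hW _ (Nat.le_add_right K j)) (hantiV (Nat.zero_le j)) hp.le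
      simp only [add_zero] at this
      linarith)
    (fun j => by
      have h1 := hrec _ (Nat.le_add_right K j)
      have h2 := hanti _ (Nat.le_add_right K j)
      have h3 := Real.rpow_nonneg (hW K le_rfl) p
      simp only [← add_assoc]
      nlinarith)
  refine ⟨2 * K + 2, (μ / 2) ^ (-(1 / p)), by positivity, fun k hk => ?_⟩
  obtain ⟨j, rfl⟩ := Nat.exists_eq_add_of_le (show K ≤ k by omega)
  refine (hD _ (Nat.le_add_right K j)).trans ?_
  rcases (hW _ (Nat.le_add_right K j)).eq_or_lt with h0 | h0
  · rw [← h0]; positivity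
  have hj : ((K + j + 2 : ℕ) : ℝ) ≤ 2 * j := by norm_cast; omega
  have h1 := hgrow j h0
  have h2 : μ / 2 * ((K + j + 2 : ℕ) : ℝ) ≤ W (K + j) ^ (-p) :=
    le_trans (by nlinarith) h1
  have h3 := Real.rpow_le_rpow_of_nonpos (by positivity) h2 (show -(1 / p) ≤ 0 by
    have : 0 < 1 / p := by positivity
    linarith)
  rw [← Real.rpow_mul h0.le, show -p * -(1 / p) = 1 by field_simp, Real.rpow_one,
    Real.mul_rpow (by positivity) (by positivity)] at h3
  exact h3

end Rates

section Convergence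

variable {E : Type*} [NormedAddCommGroup E]

/-- The length inequality of the Kurdyka-Łojasiewicz argument: sufficient decrease and the
Łojasiewicz gradient inequality at one iterate make the next step at most the decrease of
`d + M e ^ (1 - θ)`. -/
theorem step_le_sub {θ a B d d' e e' : ℝ} (hθ0 : 0 ≤ θ) (hθ1 : θ < 1) (ha : 0 < a) (hB : 0 < B)
    (hd : 0 ≤ d) (he : 0 ≤ e) (he' : 0 ≤ e') (hdesc : a * d' ^ 2 ≤ e - e')
    (hloj : 0 < e → e ^ θ ≤ B * d) :
    d' ≤ (d + B / (a * (1 - θ)) * e ^ (1 - θ)) - (d' + B / (a * (1 - θ)) * e' ^ (1 - θ)) := by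
  have hθ : 0 < 1 - θ := by linarith
  rcases he.eq_or_lt with h0 | h0
  · have h1 : e' = e := by nlinarith [sq_nonneg d']
    have h2 : d' ^ 2 ≤ 0 := by
      rw [h1, sub_self] at hdesc
      exact le_of_mul_le_mul_left (by linarith) ha
    have h3 : d' = 0 := by simpa using le_antisymm h2 (sq_nonneg d')
    rw [h1, h3]
    linarith
  set D := e ^ (1 - θ) - e' ^ (1 - θ) with hD
  have hD0 : 0 ≤ D := by
    rw [hD, sub_nonneg]
    exact Real.rpow_le_rpow he' (by nlinarith [sq_nonneg d']) hθ.le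
  have h1 := sub_mul_le_rpow_mul_sub hθ0 hθ1 h0 he'
  rw [← hD] at h1
  set M := B / (a * (1 - θ)) with hM
  have hMpos : 0 < M := by positivity
  have h2 : d' ^ 2 ≤ d * (M * D) := by
    have h3 : (1 - θ) * (a * d' ^ 2) ≤ B * d * D :=
      (mul_le_mul_of_nonneg_left hdesc hθ.le).trans
        (h1.trans (mul_le_mul_of_nonneg_right (hloj h0) hD0))
    have h4 : d * (M * D) = B * d * D / (a * (1 - θ)) := by rw [hM]; ring
    rw [h4, le_div_iff₀ (by positivity)]
    linarith
  have h5 : 2 * d' ≤ d + M * D := by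
    refine le_of_sq_le_sq ?_ (by positivity)
    nlinarith [sq_nonneg (d - M * D)]
  rw [hD] at h5
  linarith

/-- Convergence under the Łojasiewicz inequality. A sequence with sufficient decrease of `e` to
its limit `0`, with a cluster point near which `e ^ θ` is bounded by the length of the last step,
converges to that point; the last three clauses give the rate. -/
theorem tendsto_and_rate_of_lojasiewicz {y : ℕ → E} {ys : E} {e : ℕ → ℝ} {ψ : ℕ → ℕ}
    {θ a B r : ℝ} (hθ0 : 0 ≤ θ) (hθ1 : θ < 1) (ha : 0 < a) (hB : 0 < B) (hr : 0 < r)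
    (hdesc : ∀ k, a * ‖y (k + 1) - y k‖ ^ 2 ≤ e k - e (k + 1))
    (he : Tendsto e atTop (𝓝 0))
    (hψ : Tendsto ψ atTop atTop) (hcl : Tendsto (fun k => y (ψ k)) atTop (𝓝 ys))
    (hloj : ∀ᶠ k in atTop, ‖y (k + 1) - ys‖ < r → 0 < e (k + 1) →
      e (k + 1) ^ θ ≤ B * ‖y (k + 1) - y k‖) :
    Tendsto y atTop (𝓝 ys) ∧
    (θ = 0 → ∃ k₀, ∀ k ≥ k₀, y k = ys) ∧
    (0 < θ → θ ≤ 1 / 2 → ∃ k₀ : ℕ, ∃ c : ℝ, 0 < c ∧ ∃ τ : ℝ, 0 < τ ∧ τ < 1 ∧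
      ∀ k ≥ k₀, ‖y (k + 1) - ys‖ ≤ c * τ ^ k) ∧
    (1 / 2 < θ → ∃ k₀ : ℕ, ∃ c : ℝ, 0 < c ∧
      ∀ k ≥ k₀, ‖y (k + 1) - ys‖ ≤ c * ((k + 2 : ℕ) : ℝ) ^ (-((1 - θ) / (2 * θ - 1)))) := by
  have hθ : 0 < 1 - θ := by linarith
  have hanti : Antitone e := antitone_nat_of_succ_le fun k => by
    nlinarith [hdesc k, mul_nonneg ha.le (sq_nonneg ‖y (k + 1) - y k‖)]
  have he0 : ∀ k, 0 ≤ e k := fun k => hanti.le_of_tendsto he k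
  set d : ℕ → ℝ := fun k => ‖y (k + 1) - y k‖ with hd
  have hd0 : ∀ k, 0 ≤ d k := fun k => norm_nonneg _
  have hdlim : Tendsto d atTop (𝓝 0) := by
    have h1 : Tendsto (fun k => (e k - e (k + 1)) / a) atTop (𝓝 0) := by
      simpa using (he.sub (he.comp (tendsto_add_atTop_nat 1))).div_const a
    have h2 : Tendsto (fun k => d k ^ 2) atTop (𝓝 0) :=
      squeeze_zero (fun k => sq_nonneg _) (fun k => by
        rw [le_div_iff₀ ha]; linarith [hdesc k]) h1
    have h3 := h2.sqrt
    simpa [Real.sqrt_sq (hd0 _)] using h3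
  set M := B / (a * (1 - θ)) with hM
  have hMpos : 0 < M := by positivity
  set W : ℕ → ℝ := fun k => d k + M * e (k + 1) ^ (1 - θ) with hW
  have hW0 : ∀ k, 0 ≤ W k := fun k =>
    add_nonneg (hd0 k) (mul_nonneg hMpos.le (Real.rpow_nonneg (he0 _) _))
  have hWlim : Tendsto W atTop (𝓝 0) := by
    have h1 := ((he.comp (tendsto_add_atTop_nat 1)).rpow_const (p := 1 - θ)
      (Or.inr hθ.le)).const_mul M
    rw [Real.zero_rpow hθ.ne', mul_zero] at h1
    simpa using hdlim.add h1
  obtain ⟨K₀, hK₀⟩ := eventually_atTop.1 hloj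
  have hstep : ∀ k ≥ K₀, ‖y (k + 1) - ys‖ < r → d (k + 1) ≤ W k - W (k + 1) := fun k hk hkr =>
    step_le_sub hθ0 hθ1 ha hB (hd0 k) (he0 _) (he0 _) (hdesc (k + 1)) (hK₀ k hk hkr)
  -- The trap: `‖y (k + 1) - ys‖ + W k` does not increase while it is below `r`.
  have htrap : ∀ K ≥ K₀, ‖y (K + 1) - ys‖ + W K < r → ∀ k ≥ K,
      ‖y (k + 1) - ys‖ + W k ≤ ‖y (K + 1) - ys‖ + W K := by
    intro K hK hKr k hk
    induction k, hk using Nat.le_induction with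
    | base => exact le_rfl
    | succ k hk ih =>
      have h1 := hstep k (hK.trans hk) (by linarith [hW0 k])
      have h2 : ‖y (k + 1 + 1) - ys‖ ≤ d (k + 1) + ‖y (k + 1) - ys‖ := by
        have := norm_add_le (y (k + 1 + 1) - y (k + 1)) (y (k + 1) - ys)
        rwa [sub_add_sub_cancel] at this
      linarith
  have hcatch : ∀ ε > 0, ∃ K ≥ K₀, ‖y (K + 1) - ys‖ + W K < ε := by
    intro ε hε
    have h1 : Tendsto (fun j => ‖y (ψ j) - ys‖ + W (ψ j) + d (ψ j)) atTop (𝓝 0) := by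
      simpa using ((tendsto_iff_norm_sub_tendsto_zero.1 hcl).add (hWlim.comp hψ)).add
        (hdlim.comp hψ)
    obtain ⟨j, hj1, hj2⟩ := ((h1.eventually (gt_mem_nhds hε)).and
      (hψ.eventually_ge_atTop K₀)).exists
    refine ⟨ψ j, hj2, ?_⟩
    have := norm_add_le (y (ψ j + 1) - y (ψ j)) (y (ψ j) - ys)
    rw [sub_add_sub_cancel] at this
    linarith
  have hconv1 : Tendsto (fun k => y (k + 1)) atTop (𝓝 ys) := by
    rw [Metric.tendsto_atTop]
    intro ε hε
    obtain ⟨K, hK, hKε⟩ := hcatch (min ε r) (lt_min hε hr)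
    refine ⟨K, fun k hk => ?_⟩
    rw [dist_eq_norm]
    have h1 := htrap K hK (hKε.trans_le (min_le_right _ _)) k hk
    linarith [hW0 k, min_le_left ε r]
  have hconv : Tendsto y atTop (𝓝 ys) := (tendsto_add_atTop_iff_nat 1).1 hconv1
  obtain ⟨K, hK, hKr⟩ := hcatch r hr
  have hball : ∀ k ≥ K, ‖y (k + 1) - ys‖ < r := fun k hk => by
    have := htrap K hK hKr k hk
    linarith [hW0 k]
  have hdW : ∀ k ≥ K, d (k + 1) ≤ W k - W (k + 1) := fun k hk =>
    hstep k (hK.trans hk) (hball k hk)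
  have hloj' : ∀ k ≥ K, 0 < e (k + 1) → e (k + 1) ^ θ ≤ B * d k := fun k hk =>
    hK₀ k (hK.trans hk) (hball k hk)
  -- The tail length bounds the distance to the limit.
  have hdist : ∀ k ≥ K, ‖y (k + 1) - ys‖ ≤ W k := by
    intro k hk
    have h1 : ∀ j, k ≤ j → ‖y (k + 1) - y (j + 1)‖ ≤ W k - W j := by
      intro j hj
      induction j, hj using Nat.le_induction with
      | base => simp
      | succ j hj ih =>
        have h2 := hdW j (le_trans hk hj)
        have h3 := norm_sub_le_norm_sub_add_norm_sub (y (k + 1)) (y (j + 1)) (y (j + 1 + 1))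
        rw [norm_sub_rev (y (j + 1))] at h3
        linarith
    have h4 : Tendsto (fun j => ‖y (k + 1) - y (j + 1)‖) atTop (𝓝 ‖y (k + 1) - ys‖) :=
      (tendsto_const_nhds.sub hconv1).norm
    refine le_of_tendsto h4 (eventually_atTop.2 ⟨k, fun j hj => ?_⟩)
    linarith [h1 j hj, hW0 j]
  refine ⟨hconv, ?_, ?_, ?_⟩
  · intro hθz
    have h1 : ∀ᶠ k in atTop, B * d k < 1 := by
      have := hdlim.const_mul B
      rw [mul_zero] at this
      exact this.eventually (gt_mem_nhds one_pos)
    obtain ⟨K₁, hK₁⟩ := eventually_atTop.1 (h1.and (eventually_ge_atTop K))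
    have hez : ∀ k ≥ K₁, e (k + 1) = 0 := by
      intro k hk
      by_contra hne
      have h2 := hloj' k (hK₁ k hk).2 (lt_of_le_of_ne (he0 _) (Ne.symm hne))
      rw [hθz, Real.rpow_zero] at h2
      linarith [(hK₁ k hk).1]
    refine ⟨K₁ + 2, fun k hk => ?_⟩
    obtain ⟨j, rfl⟩ : ∃ j, k = j + 1 + 1 := ⟨k - 2, by omega⟩
    have hj : K₁ ≤ j := by omega
    have hdz : d (j + 1) = 0 := by
      have h2 := hdesc (j + 1)
      rw [hez j hj, hez (j + 1) (by omega), sub_self] at h2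
      have h3 : d (j + 1) ^ 2 ≤ 0 := le_of_mul_le_mul_left (by linarith) ha
      simpa using le_antisymm h3 (sq_nonneg _)
    have h4 := hdist (j + 1) (hK₁ (j + 1) (by omega)).2
    simp only [hW] at h4
    rw [hdz, hez (j + 1) (by omega), Real.zero_rpow hθ.ne', mul_zero, add_zero] at h4
    exact sub_eq_zero.1 (norm_le_zero_iff.1 h4)
  all_goals
    have hephi : 0 < θ → ∀ k ≥ K, e (k + 1) ^ (1 - θ) ≤ (B * d k) ^ ((1 - θ) / θ) := by
      intro hθp k hk
      rcases (he0 (k + 1)).eq_or_lt with h0 | h0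
      · rw [← h0, Real.zero_rpow hθ.ne']
        exact Real.rpow_nonneg (mul_nonneg hB.le (hd0 k)) _
      · have h1 := Real.rpow_le_rpow (Real.rpow_nonneg h0.le _) (hloj' k hk h0)
          (div_nonneg hθ.le hθp.le)
        rwa [← Real.rpow_mul h0.le, mul_div_cancel₀ _ hθp.ne'] at h1
  · intro hθp hθh
    have hq : 1 ≤ (1 - θ) / θ := by rw [le_div_iff₀ hθp]; linarith
    have h1 : ∀ᶠ k in atTop, B * d k < 1 := by
      have := hdlim.const_mul B
      rw [mul_zero] at this
      exact this.eventually (gt_mem_nhds one_pos)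
    obtain ⟨K₁, hK₁⟩ := eventually_atTop.1 (h1.and (eventually_ge_atTop K))
    refine ⟨K₁, exists_le_geometric (W := W) (C := 1 + M * B) (by positivity)
      (fun k _ => hW0 k) (fun k hk => hdist k (hK₁ k hk).2) fun k hk => ?_⟩
    have hkK := (hK₁ k hk).2
    have h2 := hephi hθp (k + 1) (by omega)
    have h3 : (B * d (k + 1)) ^ ((1 - θ) / θ) ≤ B * d (k + 1) := by
      have := Real.rpow_le_rpow_of_exponent_ge' (mul_nonneg hB.le (hd0 (k + 1)))
        (hK₁ (k + 1) (by omega)).1.le zero_le_one hq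
      rwa [Real.rpow_one] at this
    calc W (k + 1) ≤ d (k + 1) + M * (B * d (k + 1)) := by
          simp only [hW]; gcongr; exact h2.trans h3
      _ = (1 + M * B) * d (k + 1) := by ring
      _ ≤ (1 + M * B) * (W k - W (k + 1)) := by gcongr; exact hdW k hkK
  · intro hθh
    have hθp : 0 < θ := by linarith
    have h2θ : 0 < 2 * θ - 1 := by linarith
    set q := (1 - θ) / θ with hq
    have hqpos : 0 < q := div_pos hθ hθp
    have hq1 : q ≤ 1 := by rw [hq, div_le_one hθp]; linarith
    obtain ⟨K₁, hK₁⟩ := eventually_atTop.1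
      ((hdlim.eventually (gt_mem_nhds one_pos)).and (eventually_ge_atTop K))
    -- The recursion holds with exponent `1 / q = 1 + p`, where `1 / p` is the claimed rate.
    set p := (2 * θ - 1) / (1 - θ) with hp
    have hppos : 0 < p := div_pos h2θ hθ
    have hqp : q * (1 + p) = 1 := by
      rw [hq, hp]
      field_simp
      ring
    have hCpos : 0 < 1 + M * B ^ q := by positivity
    have hrate := exists_le_rpow (W := W) (D := fun k => ‖y (k + 1) - ys‖) (p := p)
      (C := (1 + M * B ^ q) ^ (1 + p)) (K := K₁) hppos (by positivity)
      (fun k _ => hW0 k)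
      (fun k hk => by linarith [hdW k (hK₁ k hk).2, hd0 (k + 1)])
      (fun k hk => hdist k (hK₁ k hk).2) fun k hk => by
        have hkK := (hK₁ k hk).2
        have h2 := hephi hθp (k + 1) (by omega)
        have h3 : d (k + 1) ≤ d (k + 1) ^ q := by
          have := Real.rpow_le_rpow_of_exponent_ge' (hd0 (k + 1))
            (hK₁ (k + 1) (by omega)).1.le hqpos.le hq1
          rwa [Real.rpow_one] at this
        have h4 : W (k + 1) ≤ (1 + M * B ^ q) * d (k + 1) ^ q := by
          rw [Real.mul_rpow hB.le (hd0 _)] at h2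
          calc W (k + 1) ≤ d (k + 1) ^ q + M * (B ^ q * d (k + 1) ^ q) := by
                simp only [hW]; gcongr
            _ = _ := by ring
        calc W (k + 1) ^ (1 + p) ≤ ((1 + M * B ^ q) * d (k + 1) ^ q) ^ (1 + p) :=
              Real.rpow_le_rpow (hW0 _) h4 (by positivity)
          _ = (1 + M * B ^ q) ^ (1 + p) * d (k + 1) := by
              rw [Real.mul_rpow hCpos.le (Real.rpow_nonneg (hd0 _) _), ← Real.rpow_mul (hd0 _),
                hqp, Real.rpow_one]
          _ ≤ _ := by gcongr; exact hdW k hkK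
    rwa [show 1 / p = (1 - θ) / (2 * θ - 1) by rw [hp, one_div_div]] at hrate

end Convergence

/-! ### The spectral gap of `Aᵀ A` -/

section Eigenvalue

variable {m n : ℕ}

theorem adjoint_toEuclideanLin (A : Matrix (Fin m) (Fin n) ℝ) :
    LinearMap.adjoint (Matrix.toEuclideanLin A) = Matrix.toEuclideanLin A.transpose := by
  rw [← Matrix.toEuclideanLin_conjTranspose_eq_adjoint, Matrix.conjTranspose_eq_transpose_of_trivial]

theorem hasEigenvalue_toLin'_of_adjoint_comp (A : Matrix (Fin m) (Fin n) ℝ) {μ : ℝ}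
    (h : Module.End.HasEigenvalue
      (LinearMap.adjoint (Matrix.toEuclideanLin A) ∘ₗ Matrix.toEuclideanLin A) μ) :
    Module.End.HasEigenvalue (Matrix.toLin' (A.transpose * A)) μ := by
  obtain ⟨v, hv⟩ := h.exists_hasEigenvector
  have h1 := hv.apply_eq_smul
  rw [adjoint_toEuclideanLin] at h1
  refine Module.End.hasEigenvalue_of_hasEigenvector (x := v.ofLp) ⟨?_, fun h0 => hv.2 ?_⟩
  · rw [Module.End.mem_eigenspace_iff]
    have h2 := congrArg WithLp.ofLp h1
    simpa [Matrix.toEuclideanLin, Matrix.mulVec_mulVec] using h2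
  · ext i; exact congrFun h0 i

/-- The spectral gap of `Aᵀ A`: its smallest positive eigenvalue `σ` is positive, and
`σ ‖A u‖² ≤ ‖Aᵀ A u‖²`. In an eigenbasis this is `σ μᵢ ≤ μᵢ²`, true as `μᵢ = 0` or `μᵢ ≥ σ`. -/
theorem minPosEigenvalue_pos_and_le {A : Matrix (Fin m) (Fin n) ℝ} (hA : A ≠ 0) :
    0 < minPosEigenvalue A ∧ ∀ u, minPosEigenvalue A * ‖Matrix.toEuclideanLin A u‖ ^ 2 ≤
      ‖LinearMap.adjoint (Matrix.toEuclideanLin A) (Matrix.toEuclideanLin A u)‖ ^ 2 := by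
  set T := Matrix.toEuclideanLin A with hT
  set S := LinearMap.adjoint T ∘ₗ T with hS
  set s : Set ℝ := {μ : ℝ | 0 < μ ∧ Module.End.HasEigenvalue (Matrix.toLin' (A.transpose * A)) μ}
    with hs
  have hsfin : s.Finite := (Module.End.finite_hasEigenvalue _).subset fun μ h => h.2
  have hsym : S.IsSymmetric := by
    intro u v
    simp [hS, LinearMap.adjoint_inner_left, LinearMap.adjoint_inner_right]
  have hn : Module.finrank ℝ (EuclideanSpace ℝ (Fin n)) = n := by simp
  set bs := hsym.eigenvectorBasis hn with hbs
  set ev := hsym.eigenvalues hn with hev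
  have hinner : ∀ u v, (inner ℝ u (S v) : ℝ) = inner ℝ (T u) (T v) := fun u v => by
    simp [hS, LinearMap.adjoint_inner_right]
  have hev0 : ∀ i, 0 ≤ ev i := by
    intro i
    have h1 := hinner (bs i) (bs i)
    rw [hsym.apply_eigenvectorBasis hn i, real_inner_self_eq_norm_sq] at h1
    have h2 : ‖bs i‖ = 1 := bs.orthonormal.1 i
    have h3 : (inner ℝ (bs i) ((ev i) • (bs i)) : ℝ) = ev i := by
      rw [inner_smul_right, real_inner_self_eq_norm_sq, h2]; norm_num
    have h4 : ev i = ‖T (bs i)‖ ^ 2 := h3.symm.trans h1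
    rw [h4]; positivity
  have hmem : ∀ i, 0 < ev i → ev i ∈ s := fun i hi =>
    ⟨hi, hasEigenvalue_toLin'_of_adjoint_comp A (by
      simpa using hsym.hasEigenvalue_eigenvalues hn i)⟩
  have hcoord : ∀ u i, bs.repr (S u) i = ev i * bs.repr u i := fun u i => by
    simpa using hsym.eigenvectorBasis_apply_self_apply hn u i
  have hTu : ∀ u, ‖T u‖ ^ 2 = ∑ i, ev i * bs.repr u i ^ 2 := by
    intro u
    rw [← real_inner_self_eq_norm_sq, ← hinner, ← bs.repr.inner_map_map, PiLp.inner_apply]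
    refine Finset.sum_congr rfl fun i _ => ?_
    rw [hcoord]
    simp only [RCLike.inner_apply, conj_trivial]
    ring
  have hSu : ∀ u, ‖S u‖ ^ 2 = ∑ i, ev i ^ 2 * bs.repr u i ^ 2 := by
    intro u
    rw [← bs.repr.norm_map, EuclideanSpace.real_norm_sq_eq]
    refine Finset.sum_congr rfl fun i _ => ?_
    rw [hcoord, mul_pow]
  have hne : s.Nonempty := by
    by_contra hempty
    rw [Set.not_nonempty_iff_eq_empty] at hempty
    have hz : ∀ i, ev i = 0 := fun i => by
      by_contra h
      have := hmem i (lt_of_le_of_ne (hev0 i) (Ne.symm h))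
      rw [hempty] at this
      exact this
    apply hA
    have hT0 : T = 0 := by
      ext1 u
      have h1 := hTu u
      simp only [hz, zero_mul, Finset.sum_const_zero] at h1
      simpa using h1
    rw [hT] at hT0
    exact (LinearEquiv.map_eq_zero_iff _).1 hT0
  have hmin : minPosEigenvalue A ∈ s := hne.csInf_mem hsfin
  refine ⟨hmin.1, fun u => ?_⟩
  change minPosEigenvalue A * ‖T u‖ ^ 2 ≤ ‖S u‖ ^ 2
  rw [hTu, hSu, Finset.mul_sum]
  refine Finset.sum_le_sum fun i _ => ?_
  rw [← mul_assoc]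
  refine mul_le_mul_of_nonneg_right ?_ (sq_nonneg _)
  rcases (hev0 i).eq_or_lt with h0 | h0
  · rw [← h0]; simp
  · have h1 : minPosEigenvalue A ≤ ev i := csInf_le hsfin.bddBelow (hmem i h0)
    nlinarith

end Eigenvalue

/-! ### The Lyapunov function -/

section Lyapunov

variable {m n : ℕ}

local notation "𝔼" k => EuclideanSpace ℝ (Fin k)

theorem residual_add (A : Matrix (Fin m) (Fin n) ℝ) (b : 𝔼 m) (x d : 𝔼 n) :
    residual A b (x + d) = residual A b x + Matrix.toEuclideanLin A d := by
  simp only [residual, map_add]; abel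

/-- The real-valued (quadratic plus bilinear) part of the Lyapunov function, everything but
`f`. -/
noncomputable def smoothPart (A : Matrix (Fin m) (Fin n) ℝ) (b : 𝔼 m) (β γ η : ℝ)
    (x z : 𝔼 n) (lam : 𝔼 m) (zhat : 𝔼 n) : ℝ :=
  inner ℝ lam (residual A b x) + β / 2 * ‖residual A b x‖ ^ 2 + 1 / (2 * γ) * ‖x - z‖ ^ 2 +
    3 * alpha A β γ η * ‖z - zhat‖ ^ 2

theorem lyapunov_eq (f : (𝔼 n) → EReal) (A : Matrix (Fin m) (Fin n) ℝ) (b : 𝔼 m) (β γ η : ℝ)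
    (x z : 𝔼 n) (lam : 𝔼 m) (zhat : 𝔼 n) :
    lyapunov f A b β γ η (quadruple x z lam zhat) =
      f x + (smoothPart A b β γ η x z lam zhat : EReal) := by
  simp only [lyapunov, proxAugLagrangian, augLagrangian, smoothPart, quadruple, EReal.coe_add,
    add_assoc]
  rfl

theorem norm_sq_quadruple (x z : 𝔼 n) (lam : 𝔼 m) (zhat : 𝔼 n) :
    ‖quadruple x z lam zhat‖ ^ 2 = ‖x‖ ^ 2 + ‖z‖ ^ 2 + ‖lam‖ ^ 2 + ‖zhat‖ ^ 2 := by
  simp only [quadruple, WithLp.prod_norm_sq_eq_of_L2, WithLp.toLp_fst, WithLp.toLp_snd]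
  ring

theorem norm_sq_triple (x z : 𝔼 n) (lam : 𝔼 m) :
    ‖triple x z lam‖ ^ 2 = ‖x‖ ^ 2 + ‖z‖ ^ 2 + ‖lam‖ ^ 2 := by
  simp only [triple, WithLp.prod_norm_sq_eq_of_L2, WithLp.toLp_fst, WithLp.toLp_snd]
  ring

theorem quadruple_sub (x z x' z' : 𝔼 n) (lam lam' : 𝔼 m) (w w' : 𝔼 n) :
    quadruple x z lam w - quadruple x' z' lam' w' =
      quadruple (x - x') (z - z') (lam - lam') (w - w') := rfl

theorem triple_sub (x z x' z' : 𝔼 n) (lam lam' : 𝔼 m) :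
    triple x z lam - triple x' z' lam' = triple (x - x') (z - z') (lam - lam') := rfl

theorem inner_quadruple (x z x' z' : 𝔼 n) (lam lam' : 𝔼 m) (w w' : 𝔼 n) :
    (inner ℝ (quadruple x z lam w) (quadruple x' z' lam' w') : ℝ) =
      inner ℝ x x' + inner ℝ z z' + inner ℝ lam lam' + inner ℝ w w' := by
  simp only [quadruple, WithLp.prod_inner_apply]
  ring

theorem norm_triple_le_norm_quadruple (x z : 𝔼 n) (lam : 𝔼 m) (w : 𝔼 n) :
    ‖triple x z lam‖ ≤ ‖quadruple x z lam w‖ := by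
  refine le_of_sq_le_sq ?_ (norm_nonneg _)
  rw [norm_sq_triple, norm_sq_quadruple]
  linarith [sq_nonneg ‖w‖]

theorem norm_quadruple_le (x z : 𝔼 n) (lam : 𝔼 m) (w : 𝔼 n) :
    ‖quadruple x z lam w‖ ≤ ‖x‖ + ‖z‖ + ‖lam‖ + ‖w‖ := by
  refine le_of_sq_le_sq ?_ (by positivity)
  rw [norm_sq_quadruple]
  have h1 := norm_nonneg x
  have h2 := norm_nonneg z
  have h3 := norm_nonneg lam
  have h4 := norm_nonneg w
  nlinarith [mul_nonneg h1 h2, mul_nonneg h1 h3, mul_nonneg h1 h4, mul_nonneg h2 h3,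
    mul_nonneg h2 h4, mul_nonneg h3 h4]

theorem exists_norm_le_mul {k l : ℕ} (T : (𝔼 k) →ₗ[ℝ] 𝔼 l) :
    ∃ C : ℝ, 0 ≤ C ∧ ∀ u, ‖T u‖ ≤ C * ‖u‖ :=
  ⟨‖LinearMap.toContinuousLinearMap T‖, norm_nonneg _,
    fun u => (LinearMap.toContinuousLinearMap T).le_opNorm u⟩

theorem tendsto_smoothPart (A : Matrix (Fin m) (Fin n) ℝ) (b : 𝔼 m) (β γ η : ℝ)
    {x z w : ℕ → 𝔼 n} {lam : ℕ → 𝔼 m} {x₀ z₀ w₀ : 𝔼 n} {l₀ : 𝔼 m}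
    (hx : Tendsto x atTop (𝓝 x₀)) (hz : Tendsto z atTop (𝓝 z₀)) (hl : Tendsto lam atTop (𝓝 l₀))
    (hw : Tendsto w atTop (𝓝 w₀)) :
    Tendsto (fun j => smoothPart A b β γ η (x j) (z j) (lam j) (w j)) atTop
      (𝓝 (smoothPart A b β γ η x₀ z₀ l₀ w₀)) := by
  have hr : Tendsto (fun j => residual A b (x j)) atTop (𝓝 (residual A b x₀)) :=
    (((LinearMap.continuous_of_finiteDimensional (Matrix.toEuclideanLin A)).tendsto x₀).comp
      hx).sub_const b
  unfold smoothPart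
  exact (((hl.inner hr).add ((hr.norm.pow 2).const_mul _)).add
    (((hx.sub hz).norm.pow 2).const_mul _)).add (((hz.sub hw).norm.pow 2).const_mul _)

/-- The expansion of the smooth part is exact up to a bilinear term in the increments of `x` and
`λ` and nonnegative quadratic terms. -/
theorem smoothPart_add_ge {A : Matrix (Fin m) (Fin n) ℝ} {b : 𝔼 m} {β γ η : ℝ} (hβ : 0 < β)
    (hγ : 0 < γ) (hα : 0 ≤ alpha A β γ η) (x z : 𝔼 n) (lam : 𝔼 m) (w dx dz : 𝔼 n) (dl : 𝔼 m)
    (dw : 𝔼 n) :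
    smoothPart A b β γ η x z lam w +
      (inner ℝ (LinearMap.adjoint (Matrix.toEuclideanLin A) (lam + β • residual A b x) +
          (1 / γ) • (x - z)) dx +
        inner ℝ ((1 / γ) • (z - x) + (6 * alpha A β γ η) • (z - w)) dz +
        inner ℝ (residual A b x) dl + inner ℝ (-(6 * alpha A β γ η) • (z - w)) dw) +
      inner ℝ dl (Matrix.toEuclideanLin A dx) ≤
    smoothPart A b β γ η (x + dx) (z + dz) (lam + dl) (w + dw) := by
  unfold smoothPart
  rw [residual_add]
  set T := Matrix.toEuclideanLin A
  set r := residual A b x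
  set q := x - z with hq
  set s := z - w with hs
  set α := alpha A β γ η
  have h1 : x + dx - (z + dz) = q + (dx - dz) := by rw [hq]; abel
  have h2 : z + dz - (w + dw) = s + (dz - dw) := by rw [hs]; abel
  have h3 : z - x = -q := by rw [hq]; abel
  rw [h1, h2, h3, norm_add_sq_real r, norm_add_sq_real q, norm_add_sq_real s]
  simp only [inner_add_left, inner_add_right, inner_sub_right, inner_smul_left,
    LinearMap.adjoint_inner_left, inner_neg_left, smul_neg, conj_trivial, map_add, map_smul]
  have h4 : 0 ≤ β / 2 * ‖T dx‖ ^ 2 := by positivity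
  have h5 : 0 ≤ 1 / (2 * γ) * ‖dx - dz‖ ^ 2 := by positivity
  have h6 : 0 ≤ 3 * α * ‖dz - dw‖ ^ 2 := by positivity
  have h7 : 1 / (2 * γ) * (2 * (inner ℝ q dx - inner ℝ q dz)) =
      1 / γ * (inner ℝ q dx - inner ℝ q dz : ℝ) := by field_simp
  rw [real_inner_comm r dl]
  linarith

/-- A weak subgradient of `f` plus the gradient of the smooth part is a subgradient of the
Lyapunov function. -/
theorem quadruple_mem_subdiff_lyapunov {f : (𝔼 n) → EReal} {A : Matrix (Fin m) (Fin n) ℝ}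
    {b : 𝔼 m} {ρ β γ η : ℝ} (hβ : 0 < β) (hγ : 0 < γ) (hα : 0 ≤ alpha A β γ η)
    {x z : 𝔼 n} {lam : 𝔼 m} {w p : 𝔼 n} (hρ : 0 ≤ ρ) (hp : IsWeakSubgradient ρ f x p) :
    quadruple (p + (LinearMap.adjoint (Matrix.toEuclideanLin A) (lam + β • residual A b x) +
        (1 / γ) • (x - z)))
      ((1 / γ) • (z - x) + (6 * alpha A β γ η) • (z - w)) (residual A b x)
      (-(6 * alpha A β γ η) • (z - w)) ∈
    subdiff (lyapunov f A b β γ η) (quadruple x z lam w) := by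
  obtain ⟨r, hr, hp⟩ := hp
  obtain ⟨C, hC0, hC⟩ := exists_norm_le_mul (Matrix.toEuclideanLin A)
  refine frechetSubdiff_subset_subdiff _ _ (mem_frechetSubdiff_of_le (K := ρ / 2 + C)
    (r := r + smoothPart A b β γ η x z lam w) ?_ fun u => ?_)
  · rw [lyapunov_eq, hr, EReal.coe_add]
  obtain ⟨x', z', lam', w', rfl⟩ : ∃ x' z' lam' w', u = quadruple x' z' lam' w' :=
    ⟨u.fst, u.snd.fst, u.snd.snd.fst, u.snd.snd.snd, rfl⟩
  rw [lyapunov_eq]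
  refine le_trans ?_ (add_le_add_left (hp x') _)
  have h1 := smoothPart_add_ge (b := b) hβ hγ hα x z lam w (x' - x) (z' - z) (lam' - lam) (w' - w)
  rw [add_sub_cancel, add_sub_cancel, add_sub_cancel, add_sub_cancel] at h1
  norm_cast
  rw [quadruple_sub, inner_quadruple, norm_sq_quadruple, inner_add_left p]
  have h2 : -(C * (‖x' - x‖ ^ 2 + ‖lam' - lam‖ ^ 2)) ≤
      inner ℝ (lam' - lam) (Matrix.toEuclideanLin A (x' - x)) := by
    have h3 := abs_real_inner_le_norm (lam' - lam) (Matrix.toEuclideanLin A (x' - x))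
    have h4 : ‖lam' - lam‖ * ‖Matrix.toEuclideanLin A (x' - x)‖ ≤
        ‖lam' - lam‖ * (C * ‖x' - x‖) := by gcongr; exact hC _
    have h5 : ‖lam' - lam‖ * ‖x' - x‖ ≤ ‖x' - x‖ ^ 2 + ‖lam' - lam‖ ^ 2 := by
      nlinarith [sq_nonneg (‖lam' - lam‖ - ‖x' - x‖), sq_nonneg (‖lam' - lam‖ + ‖x' - x‖)]
    nlinarith [neg_abs_le (inner ℝ (lam' - lam) (Matrix.toEuclideanLin A (x' - x)) : ℝ)]
  have h6 : 0 ≤ ρ / 2 * ‖z' - z‖ ^ 2 := by positivity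
  have h7 : 0 ≤ ρ / 2 * ‖lam' - lam‖ ^ 2 := by positivity
  have h8 : 0 ≤ ρ / 2 * ‖w' - w‖ ^ 2 := by positivity
  have h9 : 0 ≤ C * ‖z' - z‖ ^ 2 := by positivity
  have h10 : 0 ≤ C * ‖w' - w‖ ^ 2 := by positivity
  nlinarith

/-- Optimality in the `x`-update. -/
theorem isWeakSubgradient_of_mem_prox_augLagrangian {f : (𝔼 n) → EReal}
    {A : Matrix (Fin m) (Fin n) ℝ} {b : 𝔼 m} {ρ β γ : ℝ} (hγ : 0 < γ) (hproper : IsProper f)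
    (hwc : IsWeaklyConvex ρ f) {x z : 𝔼 n} {lam : 𝔼 m}
    (hx : x ∈ prox γ (fun u => augLagrangian f A b β u lam) z) :
    IsWeakSubgradient ρ f x
      (-(LinearMap.adjoint (Matrix.toEuclideanLin A) (lam + β • residual A b x) +
        (1 / γ) • (x - z))) := by
  refine IsWeakSubgradient.of_isMin hproper hwc
    (G := fun u => inner ℝ lam (residual A b u) + β / 2 * ‖residual A b u‖ ^ 2 +
      1 / (2 * γ) * ‖u - z‖ ^ 2)
    (Q := fun d => β / 2 * ‖Matrix.toEuclideanLin A d‖ ^ 2 + 1 / (2 * γ) * ‖d‖ ^ 2)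
    (fun t d => ?_) fun u => ?_
  · have h1 : x + t • d - z = (x - z) + t • d := by abel
    rw [residual_add, h1, norm_add_sq_real (residual A b x), norm_add_sq_real (x - z)]
    simp only [map_smul, inner_add_left, inner_add_right, inner_smul_left, inner_smul_right,
      LinearMap.adjoint_inner_left, conj_trivial, norm_smul, mul_pow, Real.norm_eq_abs, sq_abs,
      map_add]
    field_simp
    ring
  · have h1 := hx u
    simp only [augLagrangian, add_assoc, ← EReal.coe_add] at h1
    simpa only [add_assoc] using h1

/-- Change of the Lyapunov function over one step: its decrease in the primal variables, less its
increase through the multiplier.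
Here `F₀`, `F₁` are the values of `f` at `x₀`, `x₁`. -/
theorem smoothPart_step {A : Matrix (Fin m) (Fin n) ℝ} {b : 𝔼 m} {ρ β γ η F₀ F₁ : ℝ}
    (hβ : 0 < β) (hγ : 0 < γ) (hη : 0 < η) {x₀ x₁ z₀ z₁ w : 𝔼 n} {l₀ l₁ : 𝔼 m}
    (hF : F₁ + (inner ℝ (-(LinearMap.adjoint (Matrix.toEuclideanLin A) l₁ +
      (1 / γ) • (x₁ - z₀))) (x₀ - x₁) - ρ / 2 * ‖x₀ - x₁‖ ^ 2) ≤ F₀)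
    (hz : z₁ = z₀ - η • (z₀ - x₁)) (hl : l₁ = l₀ + β • residual A b x₁) :
    (F₁ + smoothPart A b β γ η x₁ z₁ l₁ z₀) + (1 - γ * ρ) / (2 * γ) * ‖x₁ - x₀‖ ^ 2 +
      ((2 / η - 1) / (2 * γ) - 3 * alpha A β γ η) * ‖z₁ - z₀‖ ^ 2 +
      3 * alpha A β γ η * ‖z₀ - w‖ ^ 2 - 1 / β * ‖l₁ - l₀‖ ^ 2 ≤
    F₀ + smoothPart A b β γ η x₀ z₀ l₀ w := by
  unfold smoothPart
  set T := Matrix.toEuclideanLin A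
  set d := x₀ - x₁ with hd
  set v := x₁ - z₀ with hv
  have h1 : residual A b x₀ = residual A b x₁ + T d := by
    rw [← residual_add, hd, add_sub_cancel]
  set r := residual A b x₁
  have h2 : x₀ - z₀ = d + v := by rw [hd, hv]; abel
  have h3 : z₁ - z₀ = η • v := by rw [hz, hv]; module
  have h4 : x₁ - z₁ = (1 - η) • v := by rw [hz, hv]; module
  have h5 : l₁ - l₀ = β • r := by rw [hl]; abel
  have h6 : ‖x₁ - x₀‖ = ‖d‖ := norm_sub_rev _ _
  rw [h1, h2, h3, h4, h5, h6, norm_add_sq_real r, norm_add_sq_real d, hl]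
  rw [hl] at hF
  simp only [map_smul, inner_add_left, inner_add_right, inner_smul_left, inner_neg_left,
    LinearMap.adjoint_inner_left, conj_trivial, norm_smul, mul_pow, Real.norm_eq_abs, sq_abs,
    map_add, real_inner_self_eq_norm_sq] at hF ⊢
  rw [real_inner_comm d v] at hF
  have h7 : 0 ≤ β / 2 * ‖T d‖ ^ 2 := by positivity
  have h8 : 1 / β * (β ^ 2 * ‖r‖ ^ 2) = β * ‖r‖ ^ 2 := by field_simp
  have h9 : (2 / η - 1) / (2 * γ) * (η ^ 2 * ‖v‖ ^ 2) =
      1 / (2 * γ) * ‖v‖ ^ 2 - 1 / (2 * γ) * ((1 - η) ^ 2 * ‖v‖ ^ 2) := by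
    field_simp
    ring
  have h10 : (1 - γ * ρ) / (2 * γ) * ‖d‖ ^ 2 = 1 / (2 * γ) * ‖d‖ ^ 2 - ρ / 2 * ‖d‖ ^ 2 := by
    field_simp
  have h11 : 1 / (2 * γ) * (2 * inner ℝ d v) = 1 / γ * (inner ℝ d v : ℝ) := by field_simp
  have h12 : ‖z₀ - z₁‖ ^ 2 = η ^ 2 * ‖v‖ ^ 2 := by
    rw [norm_sub_rev, h3, norm_smul, mul_pow, Real.norm_eq_abs, sq_abs]
  have h13 : ‖z₁ - z₀‖ ^ 2 = η ^ 2 * ‖v‖ ^ 2 := by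
    rw [h3, norm_smul, mul_pow, Real.norm_eq_abs, sq_abs]
  linarith

/-- The multiplier increment is controlled by the primal increments: it lies in the range of `A`,
where `Aᵀ` is bounded below, and `Aᵀ λ` is determined by the subgradients of `f`. -/
theorem norm_sq_multiplier_le {f : (𝔼 n) → EReal} {A : Matrix (Fin m) (Fin n) ℝ} {b : 𝔼 m}
    {ρ β γ L : ℝ} (hA : A ≠ 0) (hfeas : ∃ u, Matrix.toEuclideanLin A u = b)
    (hγ : 0 < γ) (hγρ : γ * ρ < 1) (hLip : ImplicitLipschitzSubgradient γ f L)
    {x₁ x₂ z₀ z₁ : 𝔼 n} {l₁ l₂ : 𝔼 m}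
    (h₁ : IsWeakSubgradient ρ f x₁ (-(LinearMap.adjoint (Matrix.toEuclideanLin A) l₁ +
      (1 / γ) • (x₁ - z₀))))
    (h₂ : IsWeakSubgradient ρ f x₂ (-(LinearMap.adjoint (Matrix.toEuclideanLin A) l₂ +
      (1 / γ) • (x₂ - z₁))))
    (hl : l₂ = l₁ + β • residual A b x₂) :
    γ ^ 2 * minPosEigenvalue A * ‖l₂ - l₁‖ ^ 2 ≤
      2 * ((1 + γ * L) ^ 2 * ‖x₂ - x₁‖ ^ 2 + ‖z₁ - z₀‖ ^ 2) := by
  obtain ⟨u, rfl⟩ := hfeas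
  set T := Matrix.toEuclideanLin A with hT
  have h3 : l₂ - l₁ = T (β • (x₂ - u)) := by
    rw [hl, add_sub_cancel_left, map_smul, map_sub]; rfl
  have h4 := (minPosEigenvalue_pos_and_le hA).2 (β • (x₂ - u))
  rw [← hT, ← h3] at h4
  have h5 := hLip.norm_sub_le hγ hγρ h₂ h₁
  set p₁ := -(LinearMap.adjoint T l₁ + (1 / γ) • (x₁ - z₀)) with hp₁
  set p₂ := -(LinearMap.adjoint T l₂ + (1 / γ) • (x₂ - z₁)) with hp₂
  have h6 : γ • LinearMap.adjoint T (l₂ - l₁) =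
      -(γ • (p₂ - p₁)) + -(x₂ - x₁) + (z₁ - z₀) := by
    rw [map_sub, hp₁, hp₂]
    have : γ * (1 / γ) = 1 := by field_simp
    simp only [smul_sub, smul_add, smul_neg, smul_smul, this, one_smul]
    abel
  have h7 : γ * ‖LinearMap.adjoint T (l₂ - l₁)‖ ≤ (1 + γ * L) * ‖x₂ - x₁‖ + ‖z₁ - z₀‖ := by
    calc γ * ‖LinearMap.adjoint T (l₂ - l₁)‖ = ‖γ • LinearMap.adjoint T (l₂ - l₁)‖ := by
          rw [norm_smul, Real.norm_of_nonneg hγ.le]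
      _ ≤ ‖γ • (p₂ - p₁)‖ + ‖x₂ - x₁‖ + ‖z₁ - z₀‖ := by
          rw [h6, ← norm_neg (γ • (p₂ - p₁)), ← norm_neg (x₂ - x₁)]
          exact norm_add₃_le
      _ ≤ γ * (L * ‖x₂ - x₁‖) + ‖x₂ - x₁‖ + ‖z₁ - z₀‖ := by
          rw [norm_smul, Real.norm_of_nonneg hγ.le]; gcongr
      _ = _ := by ring
  calc γ ^ 2 * minPosEigenvalue A * ‖l₂ - l₁‖ ^ 2
      ≤ (γ * ‖LinearMap.adjoint T (l₂ - l₁)‖) ^ 2 := by nlinarith [sq_nonneg γ]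
    _ ≤ ((1 + γ * L) * ‖x₂ - x₁‖ + ‖z₁ - z₀‖) ^ 2 := by gcongr
    _ ≤ _ := by nlinarith [sq_nonneg ((1 + γ * L) * ‖x₂ - x₁‖ - ‖z₁ - z₀‖)]

/-- The constant `α` dominates `1 / (γ² σ β)`, the factor in front of the multiplier increment. -/
theorem alpha_pos_and_le {A : Matrix (Fin m) (Fin n) ℝ} (hA : A ≠ 0) {β γ η : ℝ} (hβ : 0 < β)
    (hγ : 0 < γ) (hη : 0 < η) (hη2 : η < 2) :
    0 < alpha A β γ η ∧ 1 / β ≤ alpha A β γ η * (γ ^ 2 * minPosEigenvalue A) := by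
  have hσ := (minPosEigenvalue_pos_and_le hA).1
  have h1 : 0 < γ * η * (1 - η / 2) := mul_pos (mul_pos hγ hη) (by linarith)
  refine ⟨by unfold alpha; positivity, ?_⟩
  have h2 : alpha A β γ η * (γ ^ 2 * minPosEigenvalue A) =
      1 / β + γ * η * (1 - η / 2) / (2 * β ^ 2) := by
    unfold alpha
    field_simp
  rw [h2]
  have : 0 ≤ γ * η * (1 - η / 2) / (2 * β ^ 2) := by positivity
  linarith

end Lyapunov

/-! ### The iterates -/

section Iterates

variable {m n : ℕ}

local notation "𝔼" k => EuclideanSpace ℝ (Fin k)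

/-- Sufficient decrease: under the smallness condition on `α`, the Lyapunov function decreases by a
multiple of the squared length of the step in `(x, z, λ, ẑ)`. -/
theorem exists_sufficient_decrease {f : (𝔼 n) → EReal} {A : Matrix (Fin m) (Fin n) ℝ}
    {b : 𝔼 m} {ρ γ η β L : ℝ} (hA : A ≠ 0) (hfeas : ∃ u, Matrix.toEuclideanLin A u = b)
    (hγ : 0 < γ) (hγρ : γ * ρ < 1) (hη : 0 < η) (hη2 : η < 2) (hL : 0 < L)
    (hLip : ImplicitLipschitzSubgradient γ f L) (hβ : 0 < β)
    (hα : alpha A β γ η <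
      min ((1 - γ * ρ) / (4 * γ * (1 + γ * L) ^ 2)) (1 / (8 * γ) * (2 / η - 1)))
    {x z : ℕ → 𝔼 n} {lam : ℕ → 𝔼 m} {F : ℕ → ℝ}
    (hF : ∀ k u, ((F k + (inner ℝ (-(LinearMap.adjoint (Matrix.toEuclideanLin A) (lam (k + 1)) +
      (1 / γ) • (x (k + 1) - z k))) (u - x (k + 1)) - ρ / 2 * ‖u - x (k + 1)‖ ^ 2) : ℝ) : EReal) ≤
      f u) (hfF : ∀ k, f (x (k + 1)) = F k)
    (hz : ∀ k, z (k + 1) = z k - η • (z k - x (k + 1)))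
    (hl : ∀ k, lam (k + 1) = lam k + β • residual A b (x (k + 1))) :
    ∃ a : ℝ, 0 < a ∧ ∀ k,
      a * ‖quadruple (x (k + 2)) (z (k + 2)) (lam (k + 2)) (z (k + 1)) -
        quadruple (x (k + 1)) (z (k + 1)) (lam (k + 1)) (z k)‖ ^ 2 ≤
      (F k + smoothPart A b β γ η (x (k + 1)) (z (k + 1)) (lam (k + 1)) (z k)) -
        (F (k + 1) + smoothPart A b β γ η (x (k + 2)) (z (k + 2)) (lam (k + 2)) (z (k + 1))) := by
  obtain ⟨hα0, hαβ⟩ := alpha_pos_and_le hA hβ hγ hη hη2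
  rw [lt_min_iff] at hα
  set α := alpha A β γ η with hαdef
  have hLpos : 0 < (1 + γ * L) ^ 2 := by positivity
  -- The two halves of the condition on `α` leave room for both primal increments.
  set δ := (1 - γ * ρ) / (2 * γ) - 2 * α * (1 + γ * L) ^ 2 with hδ
  have hδ0 : 0 < δ := by
    have h1 := hα.1
    rw [lt_div_iff₀ (by positivity)] at h1
    rw [hδ, sub_pos, lt_div_iff₀ (by positivity)]
    linarith
  have hηα : 4 * α ≤ (2 / η - 1) / (2 * γ) := by
    have h1 : (2 / η - 1) / (2 * γ) = 4 * (1 / (8 * γ) * (2 / η - 1)) := by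
      ring
    rw [h1]
    linarith [hα.2]
  set Λ := 2 * α * β * (1 + γ * L) ^ 2 with hΛ
  have hΛ0 : 0 < Λ := by positivity
  refine ⟨min δ α / (1 + Λ), by have := lt_min hδ0 hα0; positivity, fun k => ?_⟩
  have hstep := smoothPart_step (ρ := ρ) (w := z k) (x₀ := x (k + 1)) (F₀ := F k) hβ hγ hη
    (by have := hF (k + 1) (x (k + 1)); rw [hfF] at this; exact_mod_cast this)
    (hz (k + 1)) (hl (k + 1))
  have hdual := norm_sq_multiplier_le hA hfeas hγ hγρ hLip ⟨F k, hfF k, hF k⟩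
    ⟨F (k + 1), hfF (k + 1), hF (k + 1)⟩ (hl (k + 1))
  simp only [add_assoc, Nat.reduceAdd] at hstep hdual ⊢
  rw [← hαdef] at hstep
  rw [quadruple_sub, norm_sq_quadruple]
  set X := ‖x (k + 2) - x (k + 1)‖ ^ 2
  set Z := ‖z (k + 2) - z (k + 1)‖ ^ 2
  set Z' := ‖z (k + 1) - z k‖ ^ 2
  set D := ‖lam (k + 2) - lam (k + 1)‖ ^ 2
  have hX : 0 ≤ X := sq_nonneg _
  have hZ : 0 ≤ Z := sq_nonneg _
  have hZ' : 0 ≤ Z' := sq_nonneg _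
  have hD : 0 ≤ D := sq_nonneg _
  have h1 : 1 / β * D ≤ 2 * α * ((1 + γ * L) ^ 2 * X + Z') := by
    calc 1 / β * D ≤ α * (γ ^ 2 * minPosEigenvalue A) * D := by gcongr
      _ = α * (γ ^ 2 * minPosEigenvalue A * D) := by ring
      _ ≤ α * (2 * ((1 + γ * L) ^ 2 * X + Z')) := by gcongr
      _ = _ := by ring
  have h2 : D ≤ Λ * (X + Z') := by
    have h3 : D ≤ β * (2 * α * ((1 + γ * L) ^ 2 * X + Z')) := by
      rwa [one_div, inv_mul_le_iff₀ hβ] at h1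
    have h4 : 1 ≤ (1 + γ * L) ^ 2 := by nlinarith [mul_pos hγ hL]
    have h5 : 0 ≤ 2 * α * β * ((1 + γ * L) ^ 2 - 1) * Z' := by
      have := sub_nonneg.2 h4
      positivity
    rw [hΛ]
    linarith
  have h6 : (4 * α) * Z ≤ (2 / η - 1) / (2 * γ) * Z := by gcongr
  have h7 : min δ α * (X + Z + Z') ≤ δ * X + α * Z + α * Z' := by
    have ha := mul_le_mul_of_nonneg_right (min_le_left δ α) hX
    have hb := mul_le_mul_of_nonneg_right (min_le_right δ α) hZ
    have hc := mul_le_mul_of_nonneg_right (min_le_right δ α) hZ'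
    linarith
  have h8 : min δ α / (1 + Λ) * (X + (Z + (D + Z'))) ≤ min δ α * (X + Z + Z') := by
    rw [div_mul_eq_mul_div, div_le_iff₀ (by positivity), mul_assoc]
    refine mul_le_mul_of_nonneg_left ?_ (lt_min hδ0 hα0).le
    nlinarith [mul_nonneg hΛ0.le hZ]
  have h9 : δ * X = (1 - γ * ρ) / (2 * γ) * X - 2 * α * (1 + γ * L) ^ 2 * X := by rw [hδ]; ring
  linarith

/-- Relative error: at an iterate the Lyapunov function has a subgradient bounded by a multiple of
the last step. -/
theorem exists_subgradient_bound {f : (𝔼 n) → EReal} {A : Matrix (Fin m) (Fin n) ℝ}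
    {b : 𝔼 m} {ρ γ η β : ℝ} (hρ : 0 ≤ ρ) (hγ : 0 < γ) (hη : 0 < η) (hβ : 0 < β)
    (hα : 0 ≤ alpha A β γ η)
    {x z : ℕ → 𝔼 n} {lam : ℕ → 𝔼 m}
    (hp : ∀ k, IsWeakSubgradient ρ f (x (k + 1))
      (-(LinearMap.adjoint (Matrix.toEuclideanLin A) (lam (k + 1)) +
        (1 / γ) • (x (k + 1) - z k))))
    (hz : ∀ k, z (k + 1) = z k - η • (z k - x (k + 1)))
    (hl : ∀ k, lam (k + 1) = lam k + β • residual A b (x (k + 1))) :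
    ∃ B : ℝ, 0 < B ∧ ∀ k, ∃ v ∈ subdiff (lyapunov f A b β γ η)
      (quadruple (x (k + 2)) (z (k + 2)) (lam (k + 2)) (z (k + 1))),
      ‖v‖ ≤ B * ‖quadruple (x (k + 2)) (z (k + 2)) (lam (k + 2)) (z (k + 1)) -
        quadruple (x (k + 1)) (z (k + 1)) (lam (k + 1)) (z k)‖ := by
  set T' := LinearMap.adjoint (Matrix.toEuclideanLin A) with hT'
  obtain ⟨C, hC0, hC⟩ := exists_norm_le_mul T'
  set α := alpha A β γ η with hαdef
  refine ⟨C + 1 / γ + (1 / γ * |1 - 1 / η| + 6 * α) + 1 / β + 6 * α, by positivity, fun k => ?_⟩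
  refine ⟨_, quadruple_mem_subdiff_lyapunov (b := b) hβ hγ hα (z := z (k + 2)) (lam := lam (k + 2))
    (w := z (k + 1)) hρ (hp (k + 1)), ?_⟩
  refine (norm_quadruple_le _ _ _ _).trans ?_
  rw [← hT', ← hαdef, quadruple_sub]
  set dx := x (k + 2) - x (k + 1)
  set dz := z (k + 2) - z (k + 1) with hdz
  set dl := lam (k + 2) - lam (k + 1) with hdl
  set dw := z (k + 1) - z k
  set N := ‖quadruple dx dz dl dw‖ with hN
  have hNsq : ‖dx‖ ^ 2 + ‖dz‖ ^ 2 + ‖dl‖ ^ 2 + ‖dw‖ ^ 2 = N ^ 2 := (norm_sq_quadruple _ _ _ _).symm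
  have hN0 : 0 ≤ N := norm_nonneg _
  have hzN : ‖dz‖ ≤ N := by
    refine le_of_sq_le_sq ?_ hN0
    rw [← hNsq]
    linarith [sq_nonneg ‖dx‖, sq_nonneg ‖dl‖, sq_nonneg ‖dw‖]
  have hlN : ‖dl‖ ≤ N := by
    refine le_of_sq_le_sq ?_ hN0
    rw [← hNsq]
    linarith [sq_nonneg ‖dx‖, sq_nonneg ‖dz‖, sq_nonneg ‖dw‖]
  have hres : residual A b (x (k + 2)) = (1 / β) • dl := by
    have h1 : dl = β • residual A b (x (k + 2)) := by rw [hdl, hl (k + 1), add_sub_cancel_left]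
    rw [h1, smul_smul, one_div_mul_cancel hβ.ne', one_smul]
  have hdz' : dz = η • (x (k + 2) - z (k + 1)) := by
    rw [hdz, hz (k + 1)]
    module
  have hzx : z (k + 2) - x (k + 2) = (1 - 1 / η) • dz := by
    have h1 : x (k + 2) - z (k + 1) = (1 / η) • dz := by
      rw [hdz', smul_smul, one_div_mul_cancel hη.ne', one_smul]
    rw [sub_smul, one_smul, ← h1, hdz]
    abel
  have e1 : -(T' (lam (k + 1 + 1)) + (1 / γ) • (x (k + 1 + 1) - z (k + 1))) +
      (T' (lam (k + 2) + β • residual A b (x (k + 1 + 1))) +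
        (1 / γ) • (x (k + 1 + 1) - z (k + 2))) = T' dl - (1 / γ) • dz := by
    have h1 : β • residual A b (x (k + 1 + 1)) = dl := by
      rw [hdl, hl (k + 1), add_sub_cancel_left]
    rw [h1, map_add, hdz]
    simp only [add_assoc, Nat.reduceAdd]
    module
  rw [e1]
  simp only [add_assoc]
  rw [hres, hzx]
  have n1 : ‖T' dl - (1 / γ) • dz‖ ≤ C * N + 1 / γ * N := by
    refine (norm_sub_le _ _).trans (add_le_add ((hC dl).trans (by gcongr)) ?_)
    rw [norm_smul, Real.norm_of_nonneg (by positivity)]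
    gcongr
  have n2 : ‖(1 / γ) • (1 - 1 / η) • dz + (6 * α) • dz‖ ≤
      1 / γ * (|1 - 1 / η| * N) + 6 * α * N := by
    refine (norm_add_le _ _).trans (add_le_add ?_ ?_)
    · rw [norm_smul, norm_smul, Real.norm_of_nonneg (show 0 ≤ 1 / γ by positivity),
        Real.norm_eq_abs]
      gcongr
    · rw [norm_smul, Real.norm_of_nonneg (by positivity)]
      gcongr
  have n3 : ‖(1 / β) • dl‖ ≤ 1 / β * N := by
    rw [norm_smul, Real.norm_of_nonneg (by positivity)]
    gcongr
  have n4 : ‖-(6 * α) • dz‖ ≤ 6 * α * N := by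
    rw [neg_smul, norm_neg, norm_smul, Real.norm_of_nonneg (by positivity)]
    gcongr
  refine (add_le_add n1 (add_le_add n2 (add_le_add n3 n4))).trans (le_of_eq ?_)
  ring

/-- Weak subgradients along a convergent sequence pin the values: lower semicontinuity bounds the
value at the limit from above by the limit of the values, the subgradient inequality from below. -/
theorem IsWeakSubgradient.value_eq_of_tendsto {V : Type*} [NormedAddCommGroup V]
    [InnerProductSpace ℝ V] {f : V → EReal} (hlsc : LowerSemicontinuous f) {ρ : ℝ}
    {x p : ℕ → V} {xs ps : V} {F : ℕ → ℝ} {r s : ℝ}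
    (hx : Tendsto x atTop (𝓝 xs)) (hp : Tendsto p atTop (𝓝 ps)) (hF : Tendsto F atTop (𝓝 s))
    (hfF : ∀ k, f (x k) = F k) (hr : f xs = r)
    (hsub : ∀ k u, ((F k + (inner ℝ (p k) (u - x k) - ρ / 2 * ‖u - x k‖ ^ 2) : ℝ) : EReal) ≤
      f u) : r = s := by
  apply le_antisymm
  · refine le_of_forall_lt fun c hc => ?_
    obtain ⟨c', hc', hc'r⟩ := exists_between hc
    have h1 := hx.eventually (hlsc xs c' (show (c' : EReal) < f xs by rw [hr]; exact_mod_cast hc'r))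
    refine hc'.trans_le (ge_of_tendsto hF ?_)
    filter_upwards [h1] with k hk
    rw [hfF] at hk
    exact (EReal.coe_lt_coe_iff.1 hk).le
  · have h1 : Tendsto (fun k => F k + (inner ℝ (p k) (xs - x k) - ρ / 2 * ‖xs - x k‖ ^ 2)) atTop
        (𝓝 (s + (inner ℝ ps (xs - xs) - ρ / 2 * ‖xs - xs‖ ^ 2))) :=
      hF.add ((hp.inner (tendsto_const_nhds.sub hx)).sub
        (((tendsto_const_nhds.sub hx).norm.pow 2).const_mul _))
    simp only [sub_self, inner_zero_right, norm_zero, ne_eq, OfNat.ofNat_ne_zero,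
      not_false_eq_true, zero_pow, mul_zero, add_zero] at h1
    refine le_of_tendsto h1 (Eventually.of_forall fun k => ?_)
    have h2 := hsub k xs
    rw [hr] at h2
    exact_mod_cast h2

/-- The Kurdyka-Łojasiewicz inequality rearranged into `(h y - h ys) ^ θ ≤ C ‖v‖` for every
subgradient `v` at a point `y` near `ys` with value slightly above `h ys`. -/
theorem HasKLPropertyAt.exists_rpow_le {V : Type*} [NormedAddCommGroup V] [InnerProductSpace ℝ V]
    {h : V → EReal} {θ s : ℝ} {ys : V} (hKL : HasKLPropertyAt h θ ys) (hθ1 : θ < 1)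
    (hs : h ys = s) :
    ∃ r > 0, ∃ ν > 0, ∃ C > 0, ∀ (y v : V) (t : ℝ), ‖y - ys‖ < r → h y = t → 0 < t - s →
      t - s < ν → v ∈ subdiff h y → (t - s) ^ θ ≤ C * ‖v‖ := by
  obtain ⟨-, U, hU, ν, hν, c, hc, hKL⟩ := hKL
  obtain ⟨r, hr, hrU⟩ := Metric.mem_nhds_iff.1 hU
  have hθ : 0 < 1 - θ := by linarith
  refine ⟨r, hr, ν, hν, c * (1 - θ), by positivity, fun y v t hy ht hpos hlt hv => ?_⟩
  have h1 := hKL y (hrU (by rwa [Metric.mem_ball, dist_eq_norm])) ⟨v, hv⟩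
    (by rw [hs, ht]; exact_mod_cast sub_pos.1 hpos)
    (by rw [hs, ht]; exact_mod_cast (by linarith : t < s + ν))
  rw [hs, ht, EReal.toReal_coe, EReal.toReal_coe] at h1
  have h2 : deriv (fun s : ℝ => c * s ^ (1 - θ)) (t - s) = c * (1 - θ) * (t - s) ^ (-θ) := by
    have := ((Real.hasDerivAt_rpow_const (x := t - s) (p := 1 - θ)
      (Or.inl hpos.ne')).const_mul c).deriv
    rw [this, show 1 - θ - 1 = -θ by ring, mul_assoc]
  have h3 : Metric.infDist 0 (subdiff h y) ≤ ‖v‖ := by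
    simpa using Metric.infDist_le_dist_of_mem (x := (0 : V)) hv
  rw [h2, Real.rpow_neg hpos.le] at h1
  have hpow := Real.rpow_pos_of_pos hpos θ
  have h4 : 1 ≤ c * (1 - θ) * ((t - s) ^ θ)⁻¹ * ‖v‖ :=
    h1.trans (mul_le_mul_of_nonneg_left h3 (by positivity))
  calc (t - s) ^ θ ≤ (t - s) ^ θ * (c * (1 - θ) * ((t - s) ^ θ)⁻¹ * ‖v‖) :=
        le_mul_of_one_le_right hpow.le h4
    _ = c * (1 - θ) * ‖v‖ := by field_simp

/-- The weak subgradient at the first update bounds `f`, hence the Lyapunov values, below on a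
bounded orbit. -/
theorem bddBelow_lyapunov {f : (𝔼 n) → EReal} {A : Matrix (Fin m) (Fin n) ℝ} {b : 𝔼 m}
    {ρ γ η β : ℝ} (hγ : 0 < γ) (hβ : 0 < β) (hα : 0 ≤ alpha A β γ η)
    {x z : ℕ → 𝔼 n} {lam : ℕ → 𝔼 m} {F : ℕ → ℝ} {p : 𝔼 n}
    (hF : ∀ u, ((F 0 + (inner ℝ p (u - x 1) - ρ / 2 * ‖u - x 1‖ ^ 2) : ℝ) : EReal) ≤ f u)
    (hfF : ∀ k, f (x (k + 1)) = F k)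
    (hbdd : Bornology.IsBounded (Set.range fun k => triple (x k) (z k) (lam k))) :
    BddBelow (Set.range fun k =>
      F k + smoothPart A b β γ η (x (k + 1)) (z (k + 1)) (lam (k + 1)) (z k)) := by
  set G : Triple n m → ℝ := fun t =>
    F 0 + (inner ℝ p (t.fst - x 1) - ρ / 2 * ‖t.fst - x 1‖ ^ 2) +
      inner ℝ t.snd.snd (residual A b t.fst) with hG
  have hGc : Continuous G := by
    have hT : Continuous fun t : Triple n m => Matrix.toEuclideanLin A t.fst :=
      (LinearMap.continuous_of_finiteDimensional _).comp (by fun_prop)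
    rw [hG]
    unfold residual
    fun_prop
  obtain ⟨M, hM⟩ := hbdd.isCompact_closure.bddBelow_image hGc.continuousOn
  refine ⟨M, ?_⟩
  rintro _ ⟨k, rfl⟩
  have h1 : M ≤ F 0 + (inner ℝ p (x (k + 1) - x 1) - ρ / 2 * ‖x (k + 1) - x 1‖ ^ 2) +
      inner ℝ (lam (k + 1)) (residual A b (x (k + 1))) :=
    hM ⟨triple (x (k + 1)) (z (k + 1)) (lam (k + 1)), subset_closure ⟨k + 1, rfl⟩, rfl⟩
  have h2 := hF (x (k + 1))
  rw [hfF k] at h2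
  have h3 := EReal.coe_le_coe_iff.1 h2
  have h4 : 0 ≤ β / 2 * ‖residual A b (x (k + 1))‖ ^ 2 := by positivity
  have h5 : 0 ≤ 1 / (2 * γ) * ‖x (k + 1) - z (k + 1)‖ ^ 2 := by positivity
  have h6 : 0 ≤ 3 * alpha A β γ η * ‖z (k + 1) - z k‖ ^ 2 := by positivity
  simp only [smoothPart]
  linarith

/-- Along a bounded orbit the Lyapunov values converge, and some subsequence of the iterates
converges to the point of the diagonal given by the cluster point; the limit of the values is the
value there. -/
theorem exists_subseq_lyapunov_tendsto {f : (𝔼 n) → EReal} {A : Matrix (Fin m) (Fin n) ℝ}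
    {b : 𝔼 m} {ρ γ η β a : ℝ} (hbot : ∀ u, f u ≠ ⊥) (hlsc : LowerSemicontinuous f)
    (hγ : 0 < γ) (hη : 0 < η) (hβ : 0 < β) (hα : 0 ≤ alpha A β γ η) (ha : 0 < a)
    {x z : ℕ → 𝔼 n} {lam : ℕ → 𝔼 m} {F : ℕ → ℝ} {xs : 𝔼 n} {ls : 𝔼 m}
    (hF : ∀ k u, ((F k + (inner ℝ (-(LinearMap.adjoint (Matrix.toEuclideanLin A) (lam (k + 1)) +
      (1 / γ) • (x (k + 1) - z k))) (u - x (k + 1)) - ρ / 2 * ‖u - x (k + 1)‖ ^ 2) : ℝ) : EReal) ≤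
      f u) (hfF : ∀ k, f (x (k + 1)) = F k)
    (hz : ∀ k, z (k + 1) = z k - η • (z k - x (k + 1)))
    (hdesc : ∀ k, a * ‖quadruple (x (k + 2)) (z (k + 2)) (lam (k + 2)) (z (k + 1)) -
        quadruple (x (k + 1)) (z (k + 1)) (lam (k + 1)) (z k)‖ ^ 2 ≤
      (F k + smoothPart A b β γ η (x (k + 1)) (z (k + 1)) (lam (k + 1)) (z k)) -
        (F (k + 1) + smoothPart A b β γ η (x (k + 2)) (z (k + 2)) (lam (k + 2)) (z (k + 1))))
    (hbdd : Bornology.IsBounded (Set.range fun k => triple (x k) (z k) (lam k)))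
    (hlim : MapClusterPt (xs, ls) atTop (fun k => (x k, lam k)))
    (hdom : (subdiff (lyapunov f A b β γ η) (quadruple xs xs ls xs)).Nonempty) :
    ∃ (s : ℝ) (ψ : ℕ → ℕ),
      Tendsto (fun k => F k + smoothPart A b β γ η (x (k + 1)) (z (k + 1)) (lam (k + 1)) (z k))
        atTop (𝓝 s) ∧
      Tendsto ψ atTop atTop ∧
      Tendsto (fun j => quadruple (x (ψ j + 1)) (z (ψ j + 1)) (lam (ψ j + 1)) (z (ψ j))) atTop
        (𝓝 (quadruple xs xs ls xs)) ∧
      lyapunov f A b β γ η (quadruple xs xs ls xs) = s := by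
  have hbelow := bddBelow_lyapunov (b := b) (p := -(LinearMap.adjoint (Matrix.toEuclideanLin A)
    (lam 1) + (1 / γ) • (x 1 - z 0))) hγ hβ hα (fun u => hF 0 u) hfF hbdd
  set T' := LinearMap.adjoint (Matrix.toEuclideanLin A)
  set Y : ℕ → Quadruple n m :=
    fun k => quadruple (x (k + 1)) (z (k + 1)) (lam (k + 1)) (z k) with hY
  set E : ℕ → ℝ := fun k =>
    F k + smoothPart A b β γ η (x (k + 1)) (z (k + 1)) (lam (k + 1)) (z k) with hE
  replace hdesc : ∀ k, a * ‖Y (k + 1) - Y k‖ ^ 2 ≤ E k - E (k + 1) := hdesc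
  have hanti : Antitone E := antitone_nat_of_succ_le fun k => by
    nlinarith [hdesc k, mul_nonneg ha.le (sq_nonneg ‖Y (k + 1) - Y k‖)]
  have hElim := tendsto_atTop_ciInf hanti hbelow
  set s := ⨅ k, E k
  -- Consecutive iterates merge, and so do `x` and `z`.
  have hdlim : Tendsto (fun k => Y (k + 1) - Y k) atTop (𝓝 0) := by
    have h1 : Tendsto (fun k => (E k - E (k + 1)) / a) atTop (𝓝 0) := by
      simpa using (hElim.sub (hElim.comp (tendsto_add_atTop_nat 1))).div_const a
    have h2 : Tendsto (fun k => ‖Y (k + 1) - Y k‖ ^ 2) atTop (𝓝 0) :=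
      squeeze_zero (fun k => sq_nonneg _) (fun k => by
        rw [le_div_iff₀ ha]; linarith [hdesc k]) h1
    have h3 := h2.sqrt
    simp only [Real.sqrt_sq (norm_nonneg _), Real.sqrt_zero] at h3
    exact tendsto_zero_iff_norm_tendsto_zero.2 h3
  have hzz : Tendsto (fun k => z (k + 1) - z k) atTop (𝓝 0) := by
    have h1 : Continuous fun y : Quadruple n m => y.snd.snd.snd := by fun_prop
    exact (h1.tendsto 0).comp hdlim
  have hxz : Tendsto (fun k => x (k + 1) - z k) atTop (𝓝 0) := by
    have h1 := hzz.const_smul (1 / η)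
    rw [smul_zero] at h1
    refine h1.congr fun k => ?_
    rw [hz k]
    have : z k - η • (z k - x (k + 1)) - z k = η • (x (k + 1) - z k) := by module
    rw [this, smul_smul, one_div_mul_cancel hη.ne', one_smul]
  obtain ⟨φ, hφ, hφlim⟩ := hlim.tendsto_subseq
  set ψ : ℕ → ℕ := fun j => φ (j + 1) - 1 with hψ
  have hφψ : ∀ j, φ (j + 1) = ψ j + 1 := fun j => by
    have : j + 1 ≤ φ (j + 1) := hφ.le_apply
    simp only [hψ]
    omega
  have hψlim : Tendsto ψ atTop atTop :=
    (tendsto_sub_atTop_nat 1).comp (hφ.tendsto_atTop.comp (tendsto_add_atTop_nat 1))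
  have hφlim' := hφlim.comp (tendsto_add_atTop_nat 1)
  have hx : Tendsto (fun j => x (ψ j + 1)) atTop (𝓝 xs) := by
    refine ((continuous_fst.tendsto _).comp hφlim').congr fun j => ?_
    simp [hφψ]
  have hl : Tendsto (fun j => lam (ψ j + 1)) atTop (𝓝 ls) := by
    refine ((continuous_snd.tendsto _).comp hφlim').congr fun j => ?_
    simp [hφψ]
  have hz0 : Tendsto (fun j => z (ψ j)) atTop (𝓝 xs) := by
    simpa using hx.sub (hxz.comp hψlim)
  have hz1 : Tendsto (fun j => z (ψ j + 1)) atTop (𝓝 xs) := by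
    simpa using hz0.add (hzz.comp hψlim)
  have hYlim : Tendsto (fun j => Y (ψ j)) atTop (𝓝 (quadruple xs xs ls xs)) := by
    have h1 : Continuous fun q : (𝔼 n) × (𝔼 n) × (𝔼 m) × (𝔼 n) =>
        quadruple q.1 q.2.1 q.2.2.1 q.2.2.2 := by
      unfold quadruple
      fun_prop
    exact (h1.tendsto (xs, xs, ls, xs)).comp
      (hx.prodMk_nhds (hz1.prodMk_nhds (hl.prodMk_nhds hz0)))
  -- The Lyapunov values converge to the value at the cluster point.
  obtain ⟨v₀, hv₀⟩ := hdom
  have hfin : ∃ r : ℝ, f xs = r := by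
    have h1 := hv₀.1
    rw [lyapunov_eq] at h1
    refine ⟨(f xs).toReal, (EReal.coe_toReal (fun h2 => ?_) (hbot xs)).symm⟩
    rw [h2, EReal.top_add_coe] at h1
    exact lt_irrefl _ h1
  obtain ⟨r₀, hr₀⟩ := hfin
  have hS := tendsto_smoothPart A b β γ η hx hz1 hl hz0
  have hFlim : Tendsto (fun j => F (ψ j)) atTop (𝓝 (s - smoothPart A b β γ η xs xs ls xs)) := by
    refine ((hElim.comp hψlim).sub hS).congr fun j => ?_
    simp [hE]
  have hplim : Tendsto (fun j => -(T' (lam (ψ j + 1)) + (1 / γ) • (x (ψ j + 1) - z (ψ j)))) atTop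
      (𝓝 (-(T' ls + (1 / γ) • (0 : 𝔼 n)))) :=
    ((((LinearMap.continuous_of_finiteDimensional T').tendsto ls).comp hl).add
      ((hxz.comp hψlim).const_smul _)).neg
  have hrs := IsWeakSubgradient.value_eq_of_tendsto hlsc hx hplim hFlim (fun j => hfF (ψ j)) hr₀
    (fun j => hF (ψ j))
  have hs : lyapunov f A b β γ η (quadruple xs xs ls xs) = s := by
    rw [lyapunov_eq, hr₀, ← EReal.coe_add, hrs, sub_add_cancel]
  exact ⟨s, ψ, hElim, hψlim, hYlim, hs⟩

end Iterates

end MEAL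

theorem proposition1 {m n : ℕ}
    (f : EuclideanSpace ℝ (Fin n) → EReal) (A : Matrix (Fin m) (Fin n) ℝ)
    (b : EuclideanSpace ℝ (Fin m)) (ρ γ η β L θ : ℝ)
    (x z : ℕ → EuclideanSpace ℝ (Fin n)) (lam : ℕ → EuclideanSpace ℝ (Fin m))
    (xs : EuclideanSpace ℝ (Fin n)) (ls : EuclideanSpace ℝ (Fin m))
    -- the problem: a nonzero matrix, feasible constraints, a weakly convex objective
    (hA : A ≠ 0)
    (hfeas : ∃ u, Matrix.toEuclideanLin A u = b)
    (hproper : MEAL.IsProper f) (hlsc : LowerSemicontinuous f)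
    (hρ : 0 < ρ) (hwc : MEAL.IsWeaklyConvex ρ f)
    -- the parameters
    (hγ : 0 < γ) (hγρ : γ < ρ⁻¹) (hη : 0 < η) (hη2 : η < 2)
    (hL : 0 < L) (hLip : MEAL.ImplicitLipschitzSubgradient γ f L)
    (hβ : 0 < β)
    (hα : MEAL.alpha A β γ η <
      min ((1 - γ * ρ) / (4 * γ * (1 + γ * L) ^ 2)) (1 / (8 * γ) * (2 / η - 1)))
    -- the sequence
    (hseq : MEAL.IsMEALSequence f A b β γ η x z lam)
    (hbdd : Bornology.IsBounded (Set.range fun k => MEAL.triple (x k) (z k) (lam k)))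
    (hlim : MapClusterPt (xs, ls) Filter.atTop (fun k => (x k, lam k)))
    -- the Kurdyka-Łojasiewicz property
    (hθ0 : 0 ≤ θ) (hθ1 : θ < 1)
    (hKL : MEAL.HasKLPropertyAt (MEAL.lyapunov f A b β γ η) θ (MEAL.quadruple xs xs ls xs)) :
    Filter.Tendsto (fun k => MEAL.triple (x k) (z k) (lam k)) Filter.atTop
      (nhds (MEAL.triple xs xs ls)) ∧
    (θ = 0 → ∃ k₀ : ℕ, ∀ k ≥ k₀, MEAL.triple (x k) (z k) (lam k) = MEAL.triple xs xs ls) ∧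
    (0 < θ → θ ≤ 1 / 2 → ∃ k₀ : ℕ, 0 < k₀ ∧ ∃ c : ℝ, 0 < c ∧ ∃ τ : ℝ, 0 < τ ∧ τ < 1 ∧
      ∀ k ≥ k₀, ‖MEAL.triple (x k) (z k) (lam k) - MEAL.triple xs xs ls‖ ≤ c * τ ^ k) ∧
    (1 / 2 < θ → ∃ k₀ : ℕ, 0 < k₀ ∧ ∃ c : ℝ, 0 < c ∧
      ∀ k ≥ k₀, ‖MEAL.triple (x k) (z k) (lam k) - MEAL.triple xs xs ls‖ ≤
        c * (k : ℝ) ^ (-((1 - θ) / (2 * θ - 1)))) := by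
  open MEAL in
  have hγρ' : γ * ρ < 1 := by rwa [← lt_div_iff₀ hρ, one_div]
  have hα0 := (alpha_pos_and_le hA hβ hγ hη hη2).1
  set T' := LinearMap.adjoint (Matrix.toEuclideanLin A) with hT'
  have hsub : ∀ k, IsWeakSubgradient ρ f (x (k + 1))
      (-(T' (lam (k + 1)) + (1 / γ) • (x (k + 1) - z k))) := fun k => by
    rw [hseq.lam_update k]
    exact isWeakSubgradient_of_mem_prox_augLagrangian hγ hproper hwc (hseq.x_update k)
  choose F hfF hF using hsub
  obtain ⟨a, ha, hdesc⟩ := exists_sufficient_decrease hA hfeas hγ hγρ' hη hη2 hL hLip hβ hα hF hfF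
    hseq.z_update hseq.lam_update
  obtain ⟨B, hB, herr⟩ := exists_subgradient_bound (b := b) hρ.le hγ hη hβ hα0.le
    (fun k => ⟨F k, hfF k, hF k⟩) hseq.z_update hseq.lam_update
  -- The value of `f` at `x⁰` may be `+∞`, so the Lyapunov sequence starts at the first update.
  set Y : ℕ → Quadruple n m :=
    fun k => quadruple (x (k + 1)) (z (k + 1)) (lam (k + 1)) (z k) with hY
  set E : ℕ → ℝ := fun k =>
    F k + smoothPart A b β γ η (x (k + 1)) (z (k + 1)) (lam (k + 1)) (z k) with hE
  have hEY : ∀ k, lyapunov f A b β γ η (Y k) = E k := fun k => by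
    rw [hY, lyapunov_eq, hfF, hE, EReal.coe_add]
  replace hdesc : ∀ k, a * ‖Y (k + 1) - Y k‖ ^ 2 ≤ E k - E (k + 1) := hdesc
  obtain ⟨s, ψ, hElim, hψlim, hYlim, hs⟩ := exists_subseq_lyapunov_tendsto hproper.1 hlsc hγ hη hβ
    hα0.le ha hF hfF hseq.z_update hdesc hbdd hlim hKL.1
  obtain ⟨r, hr, ν, hν, C, hC, hloj⟩ := hKL.exists_rpow_le hθ1 hs
  have he : Tendsto (fun k => E k - s) atTop (𝓝 0) := by simpa using hElim.sub_const s
  obtain ⟨hconv, hrate0, hrate1, hrate2⟩ := tendsto_and_rate_of_lojasiewicz (y := Y)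
    (e := fun k => E k - s) (B := C * B) hθ0 hθ1 ha (by positivity) hr
    (fun k => by linarith [hdesc k]) he hψlim hYlim (by
      filter_upwards [(he.comp (tendsto_add_atTop_nat 1)).eventually (gt_mem_nhds hν)] with k hk
        hkr hpos
      obtain ⟨v, hv, hvn⟩ := herr k
      calc (E (k + 1) - s) ^ θ ≤ C * ‖v‖ := hloj _ v _ hkr (hEY (k + 1)) hpos hk hv
        _ ≤ C * (B * ‖Y (k + 1) - Y k‖) := by gcongr
        _ = C * B * ‖Y (k + 1) - Y k‖ := by ring)
  -- Forgetting the last component does not increase distances.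
  have hproj : ∀ k, ‖triple (x (k + 1)) (z (k + 1)) (lam (k + 1)) - triple xs xs ls‖ ≤
      ‖Y k - quadruple xs xs ls xs‖ := fun k => by
    rw [hY, triple_sub, quadruple_sub]
    exact norm_triple_le_norm_quadruple _ _ _ _
  refine ⟨?_, fun h => ?_, fun h h' => ?_, fun h => ?_⟩
  · rw [← tendsto_add_atTop_iff_nat 1, tendsto_iff_norm_sub_tendsto_zero]
    exact squeeze_zero (fun _ => norm_nonneg _) hproj (tendsto_iff_norm_sub_tendsto_zero.1 hconv)
  · obtain ⟨k₀, hk₀⟩ := hrate0 h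
    refine ⟨k₀ + 1, fun k hk => ?_⟩
    obtain ⟨j, rfl⟩ : ∃ j, k = j + 1 := ⟨k - 1, by omega⟩
    have h1 := hproj j
    rw [hk₀ j (by omega), sub_self, norm_zero] at h1
    exact sub_eq_zero.1 (norm_le_zero_iff.1 h1)
  · obtain ⟨k₀, c, hc, τ, hτ, hτ1, hk₀⟩ := hrate1 h h'
    refine ⟨k₀ + 2, by omega, c / τ ^ 2, by positivity, τ, hτ, hτ1, fun k hk => ?_⟩
    obtain ⟨j, rfl⟩ : ∃ j, k = j + 1 + 1 := ⟨k - 2, by omega⟩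
    refine (hproj (j + 1)).trans ((hk₀ j (by omega)).trans (le_of_eq ?_))
    field_simp
    ring
  · obtain ⟨k₀, c, hc, hk₀⟩ := hrate2 h
    refine ⟨k₀ + 2, by omega, c, hc, fun k hk => ?_⟩
    obtain ⟨j, rfl⟩ : ∃ j, k = j + 2 := ⟨k - 2, by omega⟩
    exact (hproj (j + 1)).trans (hk₀ j (by omega))
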